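/- Let $A$ be a finite nonempty set and $k\ge 3$. An operation $\varphi:A^k\to A$ is a *generalized majority-minority (GMM) operation* if for all $a,b\in A$ either (1) $\varphi(x,y,\dots,y)=\varphi(y,x,\dots,y)=\dots=\varphi(y,y,\dots,x)=y$ for all $x,y\in\{a,b\}$, or (2) $\varphi(x,y,\dots,y)=\varphi(y,\dots,y,x)=x$ for all $x,y\in\{a,b\}$; $\{a,b\}$ is a *minority pair* if $a\ne b$ and (2) holds. A $j$-ary relation ($j\ge 1$) on $A$ is *invariant* under $\varphi$ if it is closed under applying $\varphi$ coordinatewise to any $k$ of its tuples; $\operatorname{Inv}(\varphi)$ is the set of all such relations. An instance $\mathcal P=(\{v_1,\dots,v_n\},A,\{C_1,\dots,C_m\})$ ($n\ge1$) of $\operatorname{CSP}(\operatorname{Inv}(\varphi))$ has constraints $C_l=((v_{i_1},\dots,v_{i_j}),S_l)$, where $j\ge 1$ and $S_l\in\operatorname{Inv}(\varphi)$ is a $j$-ary relation given by the list of its tuples. It is satisfiable if some $s:\{v_1,\dots,v_n\}\to A$ satisfies $(s(v_{i_1}),\dots,s(v_{i_j}))\in S_l$ for every $l$. Write $\operatorname{pr}_{i_1,\dots,i_j}$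 for projection to the coordinates $i_1,\dots,i_j$. For $n$-tuples $t,t'$, the pair $(t,t')$ *witnesses* $(i,a,b)$ if $t,t'$ agree in coordinates $1,\dots,i-1$, $\operatorname{pr}_i t=a$ and $\operatorname{pr}_i t'=b$. Consider the following procedures. All existential choices are made by sequential search, and the order in which $A$ and the constraint relations are listed is arbitrary. * $\mathtt{Nonempty}(R',i_1,\dots,i_j,S)$: put $U:=R'$; while there are $t_1,\dots,t_k\in U$ with $\operatorname{pr}_{i_1,\dots,i_j}\varphi(t_1,\dots,t_k)\notin\operatorname{pr}_{i_1,\dots,i_j}U$, add $\varphi(t_1,\dots,t_k)$ to $U$. Then return some $t\in U$ with $\operatorname{pr}_{i_1,\dots,i_j}t\in S$, or "no" if there is none. * $\mathtt{Fix\text{-}values}(R',a_1,\dots,a_q)$: put $U_0:=R'$; for $j=0,\dots,q-1$ build $U_{j+1}$, starting from $\emptyset$, as follows. (i) For each $(i,a,b)\in[n]\times A^2$ with $\{a,b\}$ a minority pair, if $t_1:=\mathtt{Nonempty}(U_j,j+1,i,\{(a_{j+1},a)\})$ is not "no", some $t_2,t_3\in U_j$ witness $(i,a,b)$, and $i>j+1$,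 put $t_4:=\varphi(t_1,t_2,\dots,t_2,t_3)$, $t_5:=\varphi(t_1,\dots,t_1,t_4)$ and add $t_1,t_5$ to $U_{j+1}$. (ii) For all $k'\in[k-1]$, $l_1<\dots<l_{k'}$ in $[n]$ and $d_1,\dots,d_{k'}\in A$, add $\mathtt{Nonempty}(U_j,l_1,\dots,l_{k'},j+1,\{(d_1,\dots,d_{k'},a_{j+1})\})$ to $U_{j+1}$ unless it is "no". Return $U_q$. * $\mathtt{Next\text{-}beta}(R',i_1,\dots,i_j,S)$: start with $U:=\emptyset$. (i) For each $(i,a,b)\in[n]\times A^2$ with $\{a,b\}$ a minority pair, if $t_1:=\mathtt{Nonempty}(R',i_1,\dots,i_j,i,S\times\{a\})$ is not "no" and $t_2:=\mathtt{Nonempty}(\mathtt{Fix\text{-}values}(R',\operatorname{pr}_1t_1,\dots,\operatorname{pr}_{i-1}t_1),i_1,\dots,i_j,i,S\times\{b\})$ is not "no", add $t_1,t_2$ to $U$. (ii) For all $k',l_1<\dots<l_{k'},d_1,\dots,d_{k'}$ as above, add $\mathtt{Nonempty}(R',i_1,\dots,i_j,l_1,\dots,l_{k'},S\times\{(d_1,\dots,d_{k'})\})$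 to $U$ unless it is "no". Return $U$. * $\mathtt{Next}(R',i_1,\dots,i_j,S)$: put $U_0:=R'$ and $U_{l+1}:=\mathtt{Next\text{-}beta}(U_l,i_1,\dots,i_{l+1},\operatorname{pr}_{1,\dots,l+1}S)$ for $l=0,\dots,j-1$; return $U_j$. * $\mathtt{Solve}(\mathcal P)$: fix any $d\in A$. Let $R'_0$ consist of, for each $(i,a,b)\in[n]\times A^2$ with $\{a,b\}$ a minority pair, the two $n$-tuples with $a$, respectively $b$, in coordinate $i$ and $d$ elsewhere, and, for all $k'\in[k-1]$, $l_1<\dots<l_{k'}$ in $[n]$ and $d_1,\dots,d_{k'}\in A$, the $n$-tuple with $d_x$ in coordinate $l_x$ for each $x\in[k']$ and $d$ elsewhere. For $l=0,\dots,m-1$ put $R'_{l+1}:=\mathtt{Next}(R'_l,i_1,\dots,i_j,S_{l+1})$, where $C_{l+1}=((v_{i_1},\dots,v_{i_j}),S_{l+1})$. Answer "yes" if and only if $R'_m\neq\emptyset$. Running time is counted in elementary steps: a loop iteration, reading, writing or comparing one element of $A$ or one index, or one application of $\varphi$ to $k$ given elements. **Claim.** For every $k$ there is a constant $K$ such that for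 every finite nonempty $A$, every GMM operation $\varphi:A^k\to A$ and every instance $\mathcal P$ of $\operatorname{CSP}(\operatorname{Inv}(\varphi))$ with $n\ge 1$ variables and $m$ constraints, $\mathtt{Solve}(\mathcal P)$ answers "yes" if and only if $\mathcal P$ is satisfiable; and, if all constraint scopes have length at most $n$, it halts within $$K\cdot\max(1,m)\cdot(n|A|)^{(k+1)(k+2)+2}\cdot\max(1,|S^*|)^{k+3}$$ steps, where $S^*$ is a largest constraint relation of $\mathcal P$ ($|S^*|=0$ if $m=0$). -/

import Mathlib

namespace GMM

universe u v w

/-! ## Constraint satisfaction problems, polymorphisms, GMM operations -/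

/-- A constraint over the variables `v_1, …, v_n` (the elements of `Fin n`) and the domain `A`:
a scope, which is a tuple of variables of positive length `arity` (repetitions are allowed), and a
relation of the same arity on `A`, presented by listing each of its tuples once, in any order. -/
structure Constraint (n : ℕ) (A : Type u) where
  arity : ℕ
  arity_pos : 0 < arity
  scope : Fin arity → Fin n
  tuples : List (Fin arity → A)
  nodup : tuples.Nodup

/-- The constraint relation, as a set of tuples. -/
def Constraint.rel {n : ℕ} {A : Type u} (C : Constraint n A) : Set (Fin C.arity → A) :=
  {t | t ∈ C.tuples}

/-- An instance `({v_1, …, v_n}, A, {C_1, …, C_m})` of the constraint satisfaction problem. -/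
structure CSPInstance (n : ℕ) (A : Type u) where
  constraints : List (Constraint n A)

/-- `s` is a solution if it maps the scope of each constraint into the constraint relation. -/
def CSPInstance.IsSolution {n : ℕ} {A : Type u} (P : CSPInstance n A) (s : Fin n → A) : Prop :=
  ∀ C ∈ P.constraints, (fun x => s (C.scope x)) ∈ C.rel

/-- The instance has a solution. -/
def CSPInstance.Satisfiable {n : ℕ} {A : Type u} (P : CSPInstance n A) : Prop :=
  ∃ s : Fin n → A, P.IsSolution s

/-- The number `m` of constraints. -/
def CSPInstance.numConstraints {n : ℕ} {A : Type u} (P : CSPInstance n A) : ℕ :=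
  P.constraints.length

/-- The number `|S*|` of tuples of a largest constraint relation (`0` if there is none). -/
def CSPInstance.largestRel {n : ℕ} {A : Type u} (P : CSPInstance n A) : ℕ :=
  (P.constraints.map fun C => C.tuples.length).foldr max 0

/-- The instances over `n` variables of `CSP(Γ)`, where `Γ j` is the set of the `j`-ary relations
in `Γ`: all constraint relations belong to `Γ`. -/
def CSP {A : Type u} (Γ : (j : ℕ) → Set (Set (Fin j → A))) (n : ℕ) : Set (CSPInstance n A) :=
  {P | ∀ C ∈ P.constraints, C.rel ∈ Γ C.arity}

/-- `φ` applied coordinatewise to `k` tuples. -/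
def applyTuples {k j : ℕ} {A : Type u} (φ : (Fin k → A) → A) (ts : Fin k → Fin j → A) :
    Fin j → A :=
  fun c => φ fun x => ts x c

/-- The relation `R` is invariant under `φ`. -/
def Invariant {k j : ℕ} {A : Type u} (φ : (Fin k → A) → A) (R : Set (Fin j → A)) : Prop :=
  ∀ ts : Fin k → Fin j → A, (∀ x, ts x ∈ R) → applyTuples φ ts ∈ R

/-- `Inv(φ)`: all relations invariant under `φ`. -/
def Inv {k : ℕ} {A : Type u} (φ : (Fin k → A) → A) (j : ℕ) : Set (Set (Fin j → A)) :=
  {R | Invariant φ R}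

/-- The sequence `x, y, …, y`. -/
def firstRest {k : ℕ} {α : Type u} (x y : α) : Fin k → α :=
  fun p => if p.val = 0 then x else y

/-- The sequence `y, …, y, x`. -/
def restLast {k : ℕ} {α : Type u} (y x : α) : Fin k → α :=
  fun p => if p.val + 1 = k then x else y

/-- The sequence `x, y, …, y, z`. -/
def firstMidLast {k : ℕ} {α : Type u} (x y z : α) : Fin k → α :=
  fun p => if p.val = 0 then x else if p.val + 1 = k then z else y

/-- `φ(x,y,…,y) = φ(y,x,…,y) = ⋯ = φ(y,y,…,x) = y` for all `x, y ∈ {a, b}`. -/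
def ActsAsMajority {k : ℕ} {A : Type u} (φ : (Fin k → A) → A) (a b : A) : Prop :=
  ∀ x ∈ [a, b], ∀ y ∈ [a, b], ∀ p : Fin k, φ (fun q => if q = p then x else y) = y

/-- `φ(x,y,…,y) = φ(y,…,y,x) = x` for all `x, y ∈ {a, b}`. -/
def ActsAsMinority {k : ℕ} {A : Type u} (φ : (Fin k → A) → A) (a b : A) : Prop :=
  ∀ x ∈ [a, b], ∀ y ∈ [a, b], φ (firstRest x y) = x ∧ φ (restLast y x) = x

/-- Generalized majority-minority operations. -/
def IsGMM {k : ℕ} {A : Type u} (φ : (Fin k → A) → A) : Prop :=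
  3 ≤ k ∧ ∀ a b : A, ActsAsMajority φ a b ∨ ActsAsMinority φ a b

/-- `{a, b}` is a minority pair (pairs with `a = b` count as majority pairs). -/
def MinorityPair {k : ℕ} {A : Type u} (φ : (Fin k → A) → A) (a b : A) : Prop :=
  a ≠ b ∧ ActsAsMinority φ a b

instance {k : ℕ} {A : Type u} [DecidableEq A] (φ : (Fin k → A) → A) (a b : A) :
    Decidable (MinorityPair φ a b) := by
  unfold MinorityPair ActsAsMinority; infer_instance

/-- `(t, t')` witnesses `(i, a, b)`: the tuples agree before the `i`th coordinate, where they have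
the values `a` and `b`. -/
def Witnesses {n : ℕ} {A : Type u} (t t' : Fin n → A) (i : Fin n) (a b : A) : Prop :=
  (∀ l : Fin n, l < i → t l = t' l) ∧ t i = a ∧ t' i = b

instance {n : ℕ} {A : Type u} [DecidableEq A] (t t' : Fin n → A) (i : Fin n) (a b : A) :
    Decidable (Witnesses t t' i a b) := by
  unfold Witnesses; infer_instance

/-! ## Computations with a step count

One step is: an iteration of a loop, reading, writing or comparing one element of `A` or one index,
or one application of `φ` to given elements. An operation on a tuple is charged at least the
number of the entries that it reads or writes (an application of `φ` at least `k + 1`). -/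

/-- The result of a computation, with the number of steps that it took. -/
structure Timed (α : Type u) where
  val : α
  time : ℕ

namespace Timed

/-- Return a value. -/
def ret {α : Type u} (a : α) : Timed α := ⟨a, 0⟩

/-- Run `x`, then `f` on its result; the times add up. -/
def bind {α : Type u} {β : Type v} (x : Timed α) (f : α → Timed β) : Timed β :=
  ⟨(f x.val).val, x.time + (f x.val).time⟩

/-- Spend `c` steps and continue with `x`. -/
def pay {α : Type u} (c : ℕ) (x : Timed α) : Timed α := ⟨x.val, c + x.time⟩

/-- Decide a condition in `c` steps. -/
def test (c : ℕ) (p : Prop) [Decidable p] : Timed Bool := ⟨decide p, c⟩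

end Timed

open Timed

/-- Sequential search for the first entry of the list on which `f` succeeds. -/
def findFirst {α : Type u} {β : Type v} (f : α → Timed (Option β)) : List α → Timed (Option β)
  | [] => pay 1 (ret none)
  | x :: xs => pay 1 ((f x).bind fun r =>
      match r with
      | some b => ret (some b)
      | none => findFirst f xs)

/-- Sequential test whether some entry of the list passes the test `p`. -/
def existsIn {α : Type u} (p : α → Timed Bool) : List α → Timed Bool
  | [] => pay 1 (ret false)
  | x :: xs => pay 1 ((p x).bind fun b => if b then ret true else existsIn p xs)

/-- `for each x in the list do s := body s x`. -/
def forEach {α : Type u} {σ : Type v} (body : σ → α → Timed σ) : List α → σ → Timed σ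
  | [], s => pay 1 (ret s)
  | x :: xs, s => pay 1 ((body s x).bind fun s' => forEach body xs s')

/-- `U ∪ {x}` for a set `U` stored as a list without repetitions; `c` is the cost of comparing two
elements. -/
def insertT {α : Type u} [DecidableEq α] (c : ℕ) (x : α) (U : List α) : Timed (List α) :=
  (existsIn (fun y => test c (x = y)) U).bind fun b => pay 1 (ret (if b then U else x :: U))

/-- All sequences of length `r` of entries of the list. -/
def words {α : Type u} : (r : ℕ) → List α → Timed (List (Fin r → α))
  | 0, _ => pay 1 (ret [Fin.elim0])
  | r + 1, l => (words r l).bind fun ws =>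
      forEach (fun acc x =>
        forEach (fun acc w => pay (r + 1) (ret ((Fin.cons x w : Fin (r + 1) → α) :: acc))) ws acc)
        l []

/-- The tuple `φ(t_1, …, t_k)`. -/
def applyT {k n : ℕ} {A : Type u} (φ : (Fin k → A) → A) (ts : Fin k → Fin n → A) :
    Timed (Fin n → A) :=
  pay (n * (k + 1) + 1) (ret (applyTuples φ ts))

/-- `for each (i, a, b) ∈ [n] × A² with {a, b} a minority pair do s := body s i a b`; here and
below `dom` lists the elements of `A`. -/
def forMinority {k n : ℕ} {A : Type u} {σ : Type v} [DecidableEq A] (φ : (Fin k → A) → A)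
    (dom : List A) (body : σ → Fin n → A → A → Timed σ) (s : σ) : Timed σ :=
  pay n (forEach (fun s i =>
    forEach (fun s a =>
      forEach (fun s b =>
        (test (8 * (k + 2) + 1) (MinorityPair φ a b)).bind fun isMin =>
          if isMin then body s i a b else ret s)
        dom s)
      dom s)
    (List.finRange n) s)

/-- `for each k' ∈ [q], for each l_1 < ⋯ < l_k' in [n], for each d_1, …, d_k' ∈ A do
s := body s (l_1, …, l_k') (d_1, …, d_k')`. -/
def forSubtuples {n : ℕ} {A : Type u} {σ : Type v} (q : ℕ) (dom : List A)
    (body : σ → List (Fin n) → List A → Timed σ) (s : σ) : Timed σ :=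
  forEach (fun s r =>
    pay n ((words (r + 1) (List.finRange n)).bind fun lss =>
      (words (r + 1) dom).bind fun dss =>
        forEach (fun s ls =>
          (test ((r + 1) * (r + 1)) (∀ x y : Fin (r + 1), x < y → ls x < ls y)).bind fun incr =>
            if incr then
              forEach (fun s ds => pay (2 * (r + 1)) (body s (List.ofFn ls) (List.ofFn ds))) dss s
            else ret s)
          lss s))
    (List.range q) s

/-! ## The algorithm

Sets of `n`-tuples are lists of elements of `Fin n → A`. A relation of another arity is a list of
tuples that are themselves lists, and `pr_{i_1, …, i_j} t` is `[i_1, …, i_j].map t`. -/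

section Algorithm

variable {k n : ℕ} {A : Type u} [DecidableEq A]

/-- Search for `t_1, …, t_k ∈ U` with `pr φ(t_1, …, t_k) ∉ pr U`, the projections being those to
`is`; the tuple `φ(t_1, …, t_k)` is returned. -/
def newTuple (φ : (Fin k → A) → A) (is : List (Fin n)) (U : List (Fin n → A)) :
    Timed (Option (Fin n → A)) :=
  (words k U).bind fun ws =>
    findFirst (fun ts =>
      (applyT φ ts).bind fun t =>
        (existsIn (fun u => test (2 * is.length + 1) (is.map t = is.map u)) U).bind fun old =>
          ret (if old then none else some t))
      ws

theorem existsIn_of_mem {α : Type u} {p : α → Timed Bool} {l : List α} {x : α} (hx : x ∈ l)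
    (h : (p x).val = true) : (existsIn p l).val = true := by
  induction l with
  | nil => simp at hx
  | cons y ys ih =>
    simp only [existsIn, pay, Timed.bind]
    by_cases hy : (p y).val = true
    · simp [hy, ret]
    · rcases List.mem_cons.1 hx with rfl | hx
      · exact absurd h hy
      · simpa [hy] using ih hx

theorem findFirst_eq_some {α : Type u} {β : Type v} {f : α → Timed (Option β)} {l : List α}
    {b : β} (h : (findFirst f l).val = some b) : ∃ x ∈ l, (f x).val = some b := by
  induction l with
  | nil => simp [findFirst, pay, ret] at h
  | cons y ys ih =>
    simp only [findFirst, pay, Timed.bind] at h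
    cases hy : (f y).val with
    | some c =>
      rw [hy] at h
      exact ⟨y, by simp, by rw [hy]; exact h⟩
    | none =>
      rw [hy] at h
      obtain ⟨x, hx, hb⟩ := ih h
      exact ⟨x, by simp [hx], hb⟩

theorem notMem_of_newTuple {φ : (Fin k → A) → A} {is : List (Fin n)} {U : List (Fin n → A)}
    {t : Fin n → A} (h : (newTuple φ is U).val = some t) : t ∉ U := by
  intro ht
  obtain ⟨ts, -, hts⟩ := findFirst_eq_some (f := _) (l := _) h
  replace hts : (if (existsIn (fun u => test (2 * is.length + 1)
      (is.map (applyTuples φ ts) = is.map u)) U).val = true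
      then none else some (applyTuples φ ts)) = some t := hts
  by_cases hold : (existsIn (fun u => test (2 * is.length + 1)
      (is.map (applyTuples φ ts) = is.map u)) U).val = true
  · rw [if_pos hold] at hts
    cases hts
  · rw [if_neg hold] at hts
    obtain rfl := Option.some.inj hts
    exact hold (existsIn_of_mem ht (by simp [test]))

/-- The loop `while ∃ t_1, …, t_k ∈ U with pr φ(t_1, …, t_k) ∉ pr U do
U := U ∪ {φ(t_1, …, t_k)}`. -/
def grow [Fintype A] (φ : (Fin k → A) → A) (is : List (Fin n)) (U : List (Fin n → A)) :
    Timed (List (Fin n → A)) :=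
  match _h : (newTuple φ is U).val with
  | none => ⟨U, (newTuple φ is U).time + 1⟩
  | some t =>
    ⟨(grow φ is (t :: U)).val, (newTuple φ is U).time + 1 + (grow φ is (t :: U)).time⟩
termination_by (Finset.univ.filter fun t : Fin n → A => t ∉ U).card
decreasing_by
  all_goals
    have hnew := notMem_of_newTuple _h
    apply Finset.card_lt_card
    rw [Finset.ssubset_iff_of_subset]
    · exact ⟨t, by simpa using hnew, by simp⟩
    · intro u hu
      simp only [List.mem_cons, not_or, Finset.mem_filter, Finset.mem_univ, true_and] at hu ⊢
      exact hu.2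

/-- Procedure `Nonempty(R', i_1, …, i_j, S)`; `none` is the answer "no". -/
def nonemptyProc [Fintype A] (φ : (Fin k → A) → A) (R' : List (Fin n → A)) (is : List (Fin n))
    (S : List (List A)) : Timed (Option (Fin n → A)) :=
  pay (is.length + 1) ((grow φ is R').bind fun U =>
    findFirst (fun t =>
      pay (is.length + 1)
        ((existsIn (fun s => test (is.length + 1) (is.map t = s)) S).bind fun b =>
          ret (if b then some t else none)))
      U)

/-- Search for tuples `t, t' ∈ U` that witness `(i, a, b)`; they exist if and only if
`(i, a, b) ∈ Sig_U`, for a minority pair `{a, b}`. -/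
def findWitness (U : List (Fin n → A)) (i : Fin n) (a b : A) :
    Timed (Option ((Fin n → A) × (Fin n → A))) :=
  findFirst (fun t =>
    findFirst (fun t' =>
      (test (2 * n + 1) (Witnesses t t' i a b)).bind fun h =>
        ret (if h then some (t, t') else none))
      U)
    U

/-- One iteration of the loop of `Fix-values`: from `U = U_j`, the coordinate `c = j + 1` and the
value `e = a_{j+1}`, compute `U_{j+1}`. -/
def fixStep [Fintype A] (φ : (Fin k → A) → A) (dom : List A) (U : List (Fin n → A)) (c : Fin n)
    (e : A) : Timed (List (Fin n → A)) :=
  (forMinority φ dom (fun V i a b =>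
      (nonemptyProc φ U [c, i] [[e, a]]).bind fun r =>
        match r with
        | none => ret V
        | some t₁ => (findWitness U i a b).bind fun r' =>
            match r' with
            | none => ret V
            | some (t₂, t₃) => (test 1 (c < i)).bind fun later =>
                if later then
                  (applyT φ (firstMidLast t₁ t₂ t₃)).bind fun t₄ =>
                  (applyT φ (restLast t₁ t₄)).bind fun t₅ =>
                  (insertT (n + 1) t₁ V).bind fun V' => insertT (n + 1) t₅ V'
                else ret V)
      []).bind fun V =>
  forSubtuples (k - 1) dom (fun V ls ds =>
      (nonemptyProc φ U (ls ++ [c]) [ds ++ [e]]).bind fun r =>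
        match r with
        | none => ret V
        | some t₆ => insertT (n + 1) t₆ V)
    V

/-- Procedure `Fix-values(R', a_1, …, a_m)`, for `as = [a_1, …, a_m]` with `m ≤ n`. -/
def fixValues [Fintype A] (φ : (Fin k → A) → A) (dom : List A) (R' : List (Fin n → A))
    (as : List A) : Timed (List (Fin n → A)) :=
  pay (n + 1) (forEach (fun U ce => fixStep φ dom U ce.1 ce.2) ((List.finRange n).zip as) R')

/-- The relation `S × {(d_1, …, d_q)}`. -/
def extendRel (S : List (List A)) (ds : List A) : Timed (List (List A)) :=
  forEach (fun acc s => pay (s.length + ds.length + 1) (ret ((s ++ ds) :: acc))) S []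

/-- Procedure `Next-beta(R', i_1, …, i_j, S)`. -/
def nextBeta [Fintype A] (φ : (Fin k → A) → A) (dom : List A) (R' : List (Fin n → A))
    (is : List (Fin n)) (S : List (List A)) : Timed (List (Fin n → A)) :=
  (forMinority φ dom (fun V i a b =>
      (extendRel S [a]).bind fun Sa =>
      (nonemptyProc φ R' (is ++ [i]) Sa).bind fun r =>
        match r with
        | none => ret V
        | some t₁ =>
            (pay (n + 1) (fixValues φ dom R' (((List.finRange n).take i.val).map t₁))).bind fun F =>
            (extendRel S [b]).bind fun Sb =>
            (nonemptyProc φ F (is ++ [i]) Sb).bind fun r' =>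
              match r' with
              | none => ret V
              | some t₂ => (insertT (n + 1) t₁ V).bind fun V' => insertT (n + 1) t₂ V')
      []).bind fun V =>
  forSubtuples (k - 1) dom (fun V ls ds =>
      (extendRel S ds).bind fun Sd =>
      (nonemptyProc φ R' (is ++ ls) Sd).bind fun r =>
        match r with
        | none => ret V
        | some t₃ => insertT (n + 1) t₃ V)
    V

/-- The relation `pr_{1, …, l} S`. -/
def prefixRel (l : ℕ) (S : List (List A)) : Timed (List (List A)) :=
  forEach (fun acc s => pay (l + 1) (insertT (l + 1) (s.take l) acc)) S []

/-- Procedure `Next(R', i_1, …, i_j, S)`. -/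
def next [Fintype A] (φ : (Fin k → A) → A) (dom : List A) (R' : List (Fin n → A))
    (is : List (Fin n)) (S : List (List A)) : Timed (List (Fin n → A)) :=
  forEach (fun U l =>
      (prefixRel (l + 1) S).bind fun S' =>
        pay (l + 1) (nextBeta φ dom U (is.take (l + 1)) S'))
    (List.range is.length) R'

/-- The `n`-tuple with the value `d_x` in coordinate `l_x` for all `x`, and `d` elsewhere. -/
def point (d : A) (ls : List (Fin n)) (ds : List A) : Fin n → A :=
  (ls.zip ds).foldl (fun t p => Function.update t p.1 p.2) fun _ => d

/-- A compact representation of order `k - 1` of the relation `A^n`. -/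
def initialRep (φ : (Fin k → A) → A) (dom : List A) (d : A) : Timed (List (Fin n → A)) :=
  (forMinority φ dom (fun V i a b =>
      pay (2 * (n + 1)) ((insertT (n + 1) (point d [i] [a]) V).bind fun V' =>
        insertT (n + 1) (point d [i] [b]) V'))
      []).bind fun V =>
  forSubtuples (k - 1) dom (fun V ls ds =>
      pay (n + 2 * ls.length + 1) (insertT (n + 1) (point d ls ds) V))
    V

/-- The algorithm: from a representation of `A^n`, process the constraints one by one by calls to
`Next`, and answer "yes" (`true`) if and only if the last representation is nonempty. -/
def solve [Fintype A] (φ : (Fin k → A) → A) (dom : List A) (d : A) (P : CSPInstance n A) :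
    Timed Bool :=
  (initialRep φ dom d).bind fun R₀ =>
  (forEach (fun U (C : Constraint n A) =>
      pay (C.arity * (C.tuples.length + 1))
        (next φ dom U (List.ofFn C.scope) (C.tuples.map fun t => List.ofFn t)))
    P.constraints R₀).bind fun R =>
  pay 1 (ret (!R.isEmpty))

end Algorithm

end GMM

/-! An invariant relation R may have exponentially many tuples, but it is determined by a small part
U that witnesses the same minority triples (i, a, b) and has the same projections to at most k - 1
coordinates: every invariant relation that contains U contains R (`IsRep.subset_of_invariant`). To
reach t ∈ R, generated tuples s are made to agree with t on longer and longer prefixes. If s i and t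
i form a minority pair, witnesses t₂, t₃ of this pair in U are carried over to s by the term φ(s, …,
s, φ(s, t₂, …, t₂, t₃)), which leaves the earlier entries alone (`witnesses_switch`). If they form a
majority pair, a near-unanimity argument by induction on sets of earlier coordinates applies, with s
itself as the remedy when a minority pair is met (`exists_agree_of_majority`).

Correctness. `Nonempty` closes U only up to the projection in question. The tuples whose projection
is present then form an invariant relation containing U, hence containing R, so every projection of
R is found (`exists_mem_grow`). With this search, `Fix-values` and `Next-beta` turn representations
of R into representations of R with coordinates fixed or with a further relation imposed
(`isRep_fixStep`, `isRep_nextBeta`). The same term shows that any tuple with entry a at i can be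
completed to a pair of witnesses, so it does not matter which tuple a search returns. `Solve` thus
carries a representation of the solutions of the constraints read so far, and a representation is
nonempty exactly when its relation is.

Time. Let N = n|A| and let s ≥ 1 bound the constraint relations. Representations have at most (k +
1) N^(k-1) tuples. Each round of `Nonempty` realises a new projection, and since `Next` imposes the
prefixes of a constraint one after another, at most s N^k projections are possible. This gives
N^((k+1)^2) s^(k+2) for `Nonempty`, N^(k^2+3k+1) for `Fix-values` (which searches for single tuples,
so s = 1), two more factors N for the minority triples in `Next-beta`, one more for the prefixes in
`Next`, and a factor m in `Solve`. The exponent of N is k^2 + 3k + 4 = (k+1)(k+2) + 2; the exponent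
k + 2 of s is one less than required. The count of projections presupposes that the lists really
represent the intended relations, so the time bounds carry the correctness invariants along. -/

namespace GMM

universe u v w

open Timed

/-! ## Values, sizes and times of the basic loops -/

section Loops

variable {α : Type u} {β : Type v} {σ : Type w}

namespace Timed

@[simp] theorem val_ret (a : α) : (ret a).val = a := rfl
@[simp] theorem time_ret (a : α) : (ret a).time = 0 := rfl
@[simp] theorem val_bind (x : Timed α) (f : α → Timed β) : (x.bind f).val = (f x.val).val := rfl
@[simp] theorem time_bind (x : Timed α) (f : α → Timed β) :
    (x.bind f).time = x.time + (f x.val).time := rfl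
@[simp] theorem val_pay (c : ℕ) (x : Timed α) : (pay c x).val = x.val := rfl
@[simp] theorem time_pay (c : ℕ) (x : Timed α) : (pay c x).time = c + x.time := rfl
@[simp] theorem val_test (c : ℕ) (p : Prop) [Decidable p] : (test c p).val = decide p := rfl
@[simp] theorem time_test (c : ℕ) (p : Prop) [Decidable p] : (test c p).time = c := rfl

end Timed

theorem existsIn_val (p : α → Timed Bool) (l : List α) :
    (existsIn p l).val = l.any fun x => (p x).val := by
  induction l with
  | nil => rfl
  | cons x xs ih =>
    simp only [existsIn, val_pay, val_bind, List.any_cons]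
    cases (p x).val <;> simp [ih]

theorem existsIn_time {p : α → Timed Bool} {l : List α} {c : ℕ}
    (h : ∀ x ∈ l, (p x).time ≤ c) : (existsIn p l).time ≤ l.length * (c + 1) + 1 := by
  induction l with
  | nil => simp [existsIn]
  | cons x xs ih =>
    have h1 := h x (by simp)
    have h2 := ih fun y hy => h y (by simp [hy])
    simp only [existsIn, time_pay, time_bind, List.length_cons]
    cases (p x).val <;> simp <;> linarith [Nat.zero_le (xs.length * (c + 1))]

theorem findFirst_eq_none {f : α → Timed (Option β)} {l : List α}
    (h : (findFirst f l).val = none) : ∀ x ∈ l, (f x).val = none := by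
  induction l with
  | nil => simp
  | cons y ys ih =>
    simp only [findFirst, val_pay, val_bind] at h
    cases hy : (f y).val with
    | some c => simp [hy] at h
    | none =>
      rw [hy] at h
      simpa [hy] using ih h

theorem findFirst_time {f : α → Timed (Option β)} {l : List α} {c : ℕ}
    (h : ∀ x ∈ l, (f x).time ≤ c) : (findFirst f l).time ≤ l.length * (c + 1) + 1 := by
  induction l with
  | nil => simp [findFirst]
  | cons x xs ih =>
    have h1 := h x (by simp)
    have h2 := ih fun y hy => h y (by simp [hy])
    simp only [findFirst, time_pay, time_bind, List.length_cons]
    cases (f x).val <;> simp <;> linarith [Nat.zero_le (xs.length * (c + 1))]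

/-- A loop preserves an invariant that depends on the number of the completed iterations. -/
theorem forEach_invariant {body : σ → α → Timed σ} {l : List α} (I : ℕ → σ → Prop)
    (h : ∀ (j : ℕ) (hj : j < l.length) (s : σ), I j s → I (j + 1) (body s l[j]).val)
    {s : σ} (hs : I 0 s) : I l.length (forEach body l s).val := by
  induction l generalizing I s with
  | nil => exact hs
  | cons x xs ih =>
    exact ih (fun j => I (j + 1)) (fun j hj s hs => h (j + 1) (by simpa using hj) s hs)
      (h 0 (by simp) s hs)

/-- The time of a loop with an invariant that depends on the number of the completed iterations. -/
theorem forEach_time {body : σ → α → Timed σ} {l : List α} {T : ℕ} (I : ℕ → σ → Prop)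
    (h : ∀ (j : ℕ) (hj : j < l.length) (s : σ), I j s →
      I (j + 1) (body s l[j]).val ∧ (body s l[j]).time ≤ T)
    {s : σ} (hs : I 0 s) : (forEach body l s).time ≤ l.length * (T + 1) + 1 := by
  induction l generalizing I s with
  | nil => simp [forEach]
  | cons x xs ih =>
    have h1 := h 0 (by simp) s hs
    have h2 := ih (fun j => I (j + 1)) (fun j hj s hs => h (j + 1) (by simpa using hj) s hs) h1.1
    have h3 := h1.2
    simp only [List.getElem_cons_zero] at h2 h3
    simp only [forEach, time_pay, time_bind, List.length_cons]
    linarith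

/-- The growth of a measure of the state during a loop. -/
theorem forEach_measure {body : σ → α → Timed σ} {l : List α} (μ : σ → ℕ) {g : ℕ}
    (h : ∀ s, ∀ x ∈ l, μ (body s x).val ≤ μ s + g) (s : σ) :
    μ (forEach body l s).val ≤ μ s + l.length * g := by
  induction l generalizing s with
  | nil => simp [forEach]
  | cons x xs ih =>
    have h1 := h s x (by simp)
    have h2 := ih (fun s y hy => h s y (by simp [hy])) (body s x).val
    simp only [forEach, val_pay, val_bind, List.length_cons]
    linarith

/-- The time of a loop whose body takes time at most `T` as long as the measure of the state, which
grows by at most `g` in an iteration, does not exceed `M`. -/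
theorem forEach_time_measure {body : σ → α → Timed σ} {l : List α} (μ : σ → ℕ) {g M T : ℕ}
    (h : ∀ s, ∀ x ∈ l, μ (body s x).val ≤ μ s + g)
    (hT : ∀ s, ∀ x ∈ l, μ s + g ≤ M → (body s x).time ≤ T) {s : σ} (hs : μ s + l.length * g ≤ M) :
    (forEach body l s).time ≤ l.length * (T + 1) + 1 := by
  induction l generalizing s with
  | nil => simp [forEach]
  | cons x xs ih =>
    have h1 := h s x (by simp)
    have hs' : μ s + (xs.length * g + g) ≤ M := by
      simpa [List.length_cons, Nat.add_mul] using hs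
    have h2 := ih (s := (body s x).val) (fun s y hy => h s y (by simp [hy]))
      (fun s y hy => hT s y (by simp [hy])) (by omega)
    have h3 := hT s x (by simp) (by omega)
    simp only [forEach, time_pay, time_bind, List.length_cons]
    linarith

/-- The elements collected by a loop. -/
theorem mem_forEach {body : List β → α → Timed (List β)} {l : List α} {F : α → β → Prop}
    (h : ∀ V, ∀ x ∈ l, ∀ t, t ∈ (body V x).val ↔ t ∈ V ∨ F x t) (V : List β) (t : β) :
    t ∈ (forEach body l V).val ↔ t ∈ V ∨ ∃ x ∈ l, F x t := by
  induction l generalizing V with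
  | nil => simp [forEach]
  | cons x xs ih =>
    simp only [forEach, val_pay, val_bind]
    rw [ih (fun V y hy => h V y (by simp [hy])), h V x (by simp)]
    simp [or_assoc]

theorem mem_insertT [DecidableEq α] {c : ℕ} {x y : α} {U : List α} :
    y ∈ (insertT c x U).val ↔ y ∈ U ∨ y = x := by
  simp only [insertT, val_bind, val_pay, val_ret, existsIn_val, val_test]
  by_cases h : x ∈ U
  · have : (U.any fun y => decide (x = y)) = true := by simpa using h
    simp only [this, if_true]
    exact ⟨Or.inl, fun h' => h'.elim id fun h' => h' ▸ h⟩
  · have : (U.any fun y => decide (x = y)) = false := by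
      simp only [List.any_eq_false, decide_eq_true_eq]
      rintro y hy rfl
      exact h hy
    simp [this, or_comm]

theorem length_insertT [DecidableEq α] (c : ℕ) (x : α) (U : List α) :
    (insertT c x U).val.length ≤ U.length + 1 := by
  simp only [insertT, val_bind, val_pay, val_ret]
  split <;> simp

theorem time_insertT [DecidableEq α] (c : ℕ) (x : α) (U : List α) :
    (insertT c x U).time ≤ U.length * (c + 1) + 2 := by
  have := existsIn_time (p := fun y => test c (x = y)) (l := U) (c := c) (by simp)
  simp only [insertT, time_bind, time_pay, time_ret]
  omega

theorem mem_words {r : ℕ} {l : List α} {f : Fin r → α} :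
    f ∈ (words r l).val ↔ ∀ x, f x ∈ l := by
  induction r with
  | zero => simp [words]; exact Subsingleton.elim _ _
  | succ r ih =>
    simp only [words, val_bind]
    rw [mem_forEach (F := fun x f => ∃ g ∈ (words r l).val, f = Fin.cons x g)]
    · constructor
      · rintro (h | ⟨x, hx, g, hg, rfl⟩)
        · simp at h
        · intro y
          refine Fin.cases ?_ (fun y => ?_) y
          · simpa using hx
          · simpa using ih.1 hg y
      · intro h
        exact Or.inr ⟨f 0, h 0, Fin.tail f, ih.2 fun y => h y.succ, (Fin.cons_self_tail f).symm⟩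
    · intro V x _ t
      rw [mem_forEach (F := fun g f => f = (Fin.cons x g : Fin (r + 1) → α))]
      intro V g _ t
      simp [or_comm]

theorem length_words (r : ℕ) (l : List α) : (words r l).val.length ≤ l.length ^ r := by
  induction r with
  | zero => simp [words]
  | succ r ih =>
    simp only [words, val_bind]
    refine (forEach_measure List.length (g := l.length ^ r) ?_ _).trans ?_
    · intro V x _
      refine (forEach_measure List.length (g := 1) ?_ _).trans (by simpa using ih)
      intro V g _
      simp
    · simp [pow_succ, mul_comm]

/-- Passing from length r to r + 1 costs at most (r + 5) B^(r+1) beyond the recursive call, and (r +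
5)^2 + (r + 5) ≤ (r + 6)^2 explains the quadratic factor. -/
theorem time_words (r : ℕ) {l : List α} {B : ℕ} (hB : 1 ≤ B) (hl : l.length ≤ B) :
    (words r l).time ≤ (r + 5) ^ 2 * B ^ r := by
  induction r with
  | zero => simp [words]
  | succ r ih =>
    have hw : (words r l).val.length ≤ B ^ r := (length_words r l).trans (Nat.pow_le_pow_left hl r)
    simp only [words, time_bind]
    have h2 : ∀ (x : α) (V : List (Fin (r + 1) → α)),
        (forEach (fun acc w => pay (r + 1) (ret ((Fin.cons x w : Fin (r + 1) → α) :: acc)))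
          (words r l).val V).time ≤ B ^ r * (r + 2) + 1 := by
      intro x V
      refine (forEach_time (T := r + 1) (fun _ _ => True) (by simp) trivial).trans ?_
      gcongr
    have h1 := forEach_time (l := l) (s := []) (T := B ^ r * (r + 2) + 1)
      (body := fun acc x => forEach (fun acc w =>
        pay (r + 1) (ret ((Fin.cons x w : Fin (r + 1) → α) :: acc))) (words r l).val acc)
      (fun _ _ => True) (fun j hj s _ => ⟨trivial, h2 _ _⟩) trivial
    have h3 : l.length * (B ^ r * (r + 2) + 1 + 1) ≤ B * (B ^ r * (r + 2) + 1 + 1) := by gcongr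
    have h4 : B ^ r ≤ B ^ (r + 1) := Nat.pow_le_pow_right hB (by omega)
    have h5 : B ≤ B ^ (r + 1) := Nat.le_self_pow (by omega) B
    have h6 : 1 ≤ B ^ (r + 1) := Nat.one_le_pow _ _ hB
    calc _ ≤ (r + 5) ^ 2 * B ^ (r + 1) + (B * (B ^ r * (r + 2) + 1 + 1) + 1) := by
            have : (r + 5) ^ 2 * B ^ r ≤ (r + 5) ^ 2 * B ^ (r + 1) := by gcongr
            omega
      _ = (r + 5) ^ 2 * B ^ (r + 1) + (B ^ (r + 1) * (r + 2) + 2 * B + 1) := by ring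
      _ ≤ (r + 5) ^ 2 * B ^ (r + 1) + (B ^ (r + 1) * (r + 2) + 2 * B ^ (r + 1) + B ^ (r + 1)) := by
            gcongr
      _ = ((r + 5) ^ 2 + (r + 5)) * B ^ (r + 1) := by ring
      _ ≤ _ := by gcongr; nlinarith

end Loops

/-! ### The loops over minority triples and over increasing index tuples -/

section AlgorithmLoops

variable {k n : ℕ} {A : Type u}

theorem mem_forMinority [DecidableEq A] {β : Type v} {φ : (Fin k → A) → A} {dom : List A}
    {body : List β → Fin n → A → A → Timed (List β)} {F : Fin n → A → A → β → Prop}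
    (hdom : ∀ a, a ∈ dom)
    (h : ∀ V i a b t, MinorityPair φ a b → (t ∈ (body V i a b).val ↔ t ∈ V ∨ F i a b t))
    (V : List β) (t : β) :
    t ∈ (forMinority φ dom body V).val ↔
      t ∈ V ∨ ∃ i a b, MinorityPair φ a b ∧ F i a b t := by
  simp only [forMinority, val_pay]
  rw [mem_forEach (F := fun i t => ∃ a b, MinorityPair φ a b ∧ F i a b t)]
  · simp
  intro V i _ t
  rw [mem_forEach (F := fun a t => ∃ b, MinorityPair φ a b ∧ F i a b t)]
  · simp [hdom]
  intro V a _ t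
  rw [mem_forEach (F := fun b t => MinorityPair φ a b ∧ F i a b t)]
  · simp [hdom]
  intro V b _ t
  by_cases hm : MinorityPair φ a b
  · simp [hm, h]
  · simp [hm]

theorem length_forMinority [DecidableEq A] {β : Type v} {φ : (Fin k → A) → A} {dom : List A}
    {body : List β → Fin n → A → A → Timed (List β)} {g : ℕ}
    (h : ∀ V i a b, (body V i a b).val.length ≤ V.length + g) (V : List β) :
    (forMinority φ dom body V).val.length ≤
      V.length + n * (dom.length * (dom.length * g)) := by
  simp only [forMinority, val_pay]
  refine (forEach_measure List.length (g := dom.length * (dom.length * g)) ?_ V).trans (by simp)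
  intro V i _
  refine forEach_measure List.length (fun V a _ => ?_) V
  refine forEach_measure List.length (fun V b _ => ?_) V
  by_cases hm : MinorityPair φ a b
  · simpa [hm] using h V i a b
  · simp [hm]

/-- The growth bound keeps every visited state within size `M`, so the body need only be timed
there. This matters because an insertion costs time proportional to the length of the list. -/
theorem time_forMinority [DecidableEq A] {β : Type v} {φ : (Fin k → A) → A} {dom : List A}
    {body : List β → Fin n → A → A → Timed (List β)} {g M T : ℕ}
    (h : ∀ V i a b, (body V i a b).val.length ≤ V.length + g)
    (hT : ∀ V i a b, V.length + g ≤ M → (body V i a b).time ≤ T) {V : List β}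
    (hV : V.length + n * (dom.length * (dom.length * g)) ≤ M) :
    (forMinority φ dom body V).time ≤
      n + (n * (dom.length * (dom.length * (8 * (k + 2) + 2 + T) + 2) + 2) + 1) := by
  have hm : ∀ (V : List β) (i : Fin n) (a b : A),
      ((test (8 * (k + 2) + 1) (MinorityPair φ a b)).bind fun isMin =>
        if isMin then body V i a b else ret V).val.length ≤ V.length + g := by
    intro V i a b
    by_cases hm : MinorityPair φ a b
    · simpa [hm] using h V i a b
    · simp [hm]
  simp only [forMinority, time_pay]
  gcongr
  have key := forEach_time_measure (l := List.finRange n) (s := V) List.length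
    (body := fun s i => forEach (fun s a =>
      forEach (fun s b =>
        (test (8 * (k + 2) + 1) (MinorityPair φ a b)).bind fun isMin =>
          if isMin then body s i a b else ret s)
        dom s)
      dom s) (g := dom.length * (dom.length * g)) (M := M)
      (T := dom.length * (dom.length * (8 * (k + 2) + 2 + T) + 2) + 1) ?_ ?_ (by simpa using hV)
  · simpa using key
  · intro V i _
    refine forEach_measure List.length (fun V a _ => ?_) V
    exact forEach_measure List.length (fun V b _ => hm V i a b) V
  · intro V i _ hV
    refine forEach_time_measure (M := M) List.length (g := dom.length * g)
      (T := dom.length * (8 * (k + 2) + 2 + T) + 1) ?_ ?_ hV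
    · intro V a _
      exact forEach_measure List.length (fun V b _ => hm V i a b) V
    intro V a _ hV
    refine (forEach_time_measure (M := M) List.length (g := g) (T := 8 * (k + 2) + 1 + T)
      (fun V b _ => hm V i a b) ?_ hV).trans (le_of_eq (by ring))
    intro V b _ hV
    by_cases hm : MinorityPair φ a b
    · simpa [hm] using hT V i a b hV
    · simp [hm]

theorem mem_forSubtuples {β : Type v} {q : ℕ} {dom : List A}
    {body : List β → List (Fin n) → List A → Timed (List β)}
    {F : List (Fin n) → List A → β → Prop} (hdom : ∀ a, a ∈ dom)
    (h : ∀ V ls ds t, t ∈ (body V ls ds).val ↔ t ∈ V ∨ F ls ds t) (V : List β) (t : β) :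
    t ∈ (forSubtuples q dom body V).val ↔
      t ∈ V ∨ ∃ r < q, ∃ (ls : Fin (r + 1) → Fin n) (ds : Fin (r + 1) → A),
        StrictMono ls ∧ F (List.ofFn ls) (List.ofFn ds) t := by
  simp only [forSubtuples]
  rw [mem_forEach (F := fun r t => ∃ (ls : Fin (r + 1) → Fin n) (ds : Fin (r + 1) → A),
        StrictMono ls ∧ F (List.ofFn ls) (List.ofFn ds) t)]
  · simp
  intro V r _ t
  simp only [val_pay, val_bind]
  rw [mem_forEach (F := fun ls t => ∃ (ds : Fin (r + 1) → A),
        StrictMono ls ∧ F (List.ofFn ls) (List.ofFn ds) t)]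
  · simp [mem_words]
  intro V ls _ t
  have hmono : (∀ x y : Fin (r + 1), x < y → ls x < ls y) ↔ StrictMono ls :=
    ⟨fun h x y hxy => h x y hxy, fun h x y hxy => h hxy⟩
  by_cases hls : StrictMono ls
  · simp only [val_bind, val_test, decide_eq_true (hmono.2 hls), if_true]
    rw [mem_forEach (F := fun ds t => F (List.ofFn ls) (List.ofFn ds) t)]
    · simp [hls, mem_words, hdom]
    · intro V ds _ t
      simp [h]
  · simp only [val_bind, val_test, decide_eq_false (mt hmono.1 hls)]
    simp [hls]

theorem length_forSubtuples {β : Type v} {q : ℕ} {dom : List A}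
    {body : List β → List (Fin n) → List A → Timed (List β)} {g N : ℕ}
    (hN : n * dom.length = N) (hN1 : 1 ≤ N)
    (h : ∀ V ls ds, (body V ls ds).val.length ≤ V.length + g) (V : List β) :
    (forSubtuples q dom body V).val.length ≤ V.length + q * (N ^ q * g) := by
  simp only [forSubtuples]
  refine (forEach_measure List.length (g := N ^ q * g) ?_ V).trans (by simp)
  intro V r hr
  have hr' : r + 1 ≤ q := List.mem_range.1 hr
  simp only [val_pay, val_bind]
  refine (forEach_measure List.length (g := dom.length ^ (r + 1) * g) ?_ V).trans ?_
  · intro V ls _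
    by_cases hls : (∀ x y : Fin (r + 1), x < y → ls x < ls y)
    · simp only [val_bind, val_test, decide_eq_true hls, if_true]
      refine (forEach_measure List.length (g := g) ?_ V).trans ?_
      · intro V ds _
        simpa using h V _ _
      · gcongr
        exact length_words _ _
    · simp only [val_bind, val_test, decide_eq_false hls]
      simp
  · have h1 := length_words (r + 1) (List.finRange n)
    rw [List.length_finRange] at h1
    calc _ ≤ V.length + n ^ (r + 1) * (dom.length ^ (r + 1) * g) := by gcongr
      _ = V.length + N ^ (r + 1) * g := by rw [← hN]; ring
      _ ≤ _ := by gcongr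

/-- For each length r + 1 ≤ q there are at most n^(r+1) |A|^(r+1) = N^(r+1) ≤ N^q pairs of an index
sequence and a value sequence. Enumerating the two kinds of sequences separately is of no higher
order in N and goes into the factor depending on q. -/
theorem time_forSubtuples {β : Type v} {q : ℕ} {dom : List A}
    {body : List β → List (Fin n) → List A → Timed (List β)} {g M N T : ℕ}
    (hN : n * dom.length = N) (hN1 : 1 ≤ N)
    (h : ∀ V ls ds, (body V ls ds).val.length ≤ V.length + g)
    (hT : ∀ V (ls : List (Fin n)) (ds : List A), ls.length ≤ q → ds.length = ls.length →
      V.length + g ≤ M → (body V ls ds).time ≤ T)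
    {V : List β} (hV : V.length + q * (N ^ q * g) ≤ M) :
    (forSubtuples q dom body V).time ≤ 4 * (q + 5) ^ 3 * N ^ q * (T + 1) := by
  have hn : 1 ≤ n := Nat.pos_of_ne_zero (by rintro rfl; simp at hN; omega)
  have hd : 1 ≤ dom.length := Nat.pos_of_ne_zero (by intro h0; simp [h0] at hN; omega)
  have hnN : n ≤ N := hN ▸ Nat.le_mul_of_pos_right n hd
  have hdN : dom.length ≤ N := hN ▸ Nat.le_mul_of_pos_left _ hn
  have inner : ∀ (r : ℕ) (ls : Fin (r + 1) → Fin n) (V : List β),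
      ((test ((r + 1) * (r + 1)) (∀ x y : Fin (r + 1), x < y → ls x < ls y)).bind fun incr =>
            if incr then
              forEach (fun s ds => pay (2 * (r + 1)) (body s (List.ofFn ls) (List.ofFn ds)))
                (words (r + 1) dom).val V
            else ret V).val.length ≤ V.length + dom.length ^ (r + 1) * g := by
    intro r ls V
    by_cases hls : (∀ x y : Fin (r + 1), x < y → ls x < ls y)
    · simp only [val_bind, val_test, decide_eq_true hls, if_true]
      refine (forEach_measure List.length (g := g) ?_ V).trans ?_
      · intro V ds _
        simpa using h V _ _
      · gcongr
        exact length_words _ _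
    · simp only [val_bind, val_test, decide_eq_false hls]
      simp
  have outer : ∀ r < q, n ^ (r + 1) * (dom.length ^ (r + 1) * g) ≤ N ^ q * g := by
    intro r hr
    calc _ = N ^ (r + 1) * g := by rw [← hN]; ring
      _ ≤ _ := by gcongr; exacts [hr]
  have hwn : ∀ r, (words (r + 1) (List.finRange n)).val.length ≤ n ^ (r + 1) := fun r => by
    simpa using length_words (r + 1) (List.finRange n)
  simp only [forSubtuples]
  refine (forEach_time_measure List.length (g := N ^ q * g) (M := M)
    (T := 3 * (q + 5) ^ 2 * N ^ q * (T + 1)) ?_ ?_ (by simpa using hV)).trans ?_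
  · intro V r hr
    simp only [val_pay, val_bind]
    refine (forEach_measure List.length (g := dom.length ^ (r + 1) * g)
      (fun V ls _ => inner r ls V) V).trans ?_
    have := outer r (List.mem_range.1 hr)
    have h1 := hwn r
    calc _ ≤ V.length + n ^ (r + 1) * (dom.length ^ (r + 1) * g) := by gcongr
      _ ≤ _ := by omega
  · intro V r hr hV
    have hr' : r + 1 ≤ q := List.mem_range.1 hr
    simp only [time_pay, time_bind]
    have t1 := time_words (r + 1) hn (l := List.finRange n) (by simp)
    have t2 := time_words (r + 1) hd (l := dom) le_rfl
    have t3 := forEach_time_measure (l := (words (r + 1) (List.finRange n)).val) (s := V)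
      List.length (body := fun s ls =>
        (test ((r + 1) * (r + 1)) (∀ x y : Fin (r + 1), x < y → ls x < ls y)).bind fun incr =>
            if incr then
              forEach (fun s ds => pay (2 * (r + 1)) (body s (List.ofFn ls) (List.ofFn ds)))
                (words (r + 1) dom).val s
            else ret s) (M := M)
      (T := (r + 1) * (r + 1) + (dom.length ^ (r + 1) * (2 * (r + 1) + T + 1) + 1))
      (fun V ls _ => inner r ls V) ?_ ?_
    · have hNr : N ^ (r + 1) ≤ N ^ q := Nat.pow_le_pow_right hN1 hr'
      have e1 : n ^ (r + 1) ≤ N ^ q := (Nat.pow_le_pow_left hnN _).trans hNr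
      have e2 : dom.length ^ (r + 1) ≤ N ^ q := (Nat.pow_le_pow_left hdN _).trans hNr
      have e3 : n ^ (r + 1) * dom.length ^ (r + 1) ≤ N ^ q := by rw [← mul_pow, hN]; exact hNr
      have e4 : n ≤ N ^ q := hnN.trans (Nat.le_self_pow (by omega) N)
      have e5 : 1 ≤ N ^ q := Nat.one_le_pow _ _ hN1
      calc _ ≤ n + ((r + 1 + 5) ^ 2 * n ^ (r + 1) + ((r + 1 + 5) ^ 2 * dom.length ^ (r + 1) +
            (n ^ (r + 1) * ((r + 1) * (r + 1) +
              (dom.length ^ (r + 1) * (2 * (r + 1) + T + 1) + 1) + 1) + 1))) := by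
              have := Nat.mul_le_mul_right ((r + 1) * (r + 1) +
              (dom.length ^ (r + 1) * (2 * (r + 1) + T + 1) + 1) + 1) (hwn r)
              omega
        _ = n + (r + 1 + 5) ^ 2 * n ^ (r + 1) + (r + 1 + 5) ^ 2 * dom.length ^ (r + 1) +
            n ^ (r + 1) * ((r + 1) * (r + 1) + 2) +
            (n ^ (r + 1) * dom.length ^ (r + 1)) * (2 * (r + 1) + T + 1) + 1 := by ring
        _ ≤ N ^ q + (q + 5) ^ 2 * N ^ q + (q + 5) ^ 2 * N ^ q + N ^ q * (q * q + 2) +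
            N ^ q * (2 * q + T + 1) + N ^ q := by gcongr
        _ = N ^ q * (3 * (q ^ 2 + 7 * q) + 55 + q + T) := by ring
        _ ≤ N ^ q * (3 * (q + 5) ^ 2 + T) := by gcongr; nlinarith
        _ ≤ N ^ q * (3 * (q + 5) ^ 2 * (T + 1)) := by
          gcongr; nlinarith [Nat.mul_le_mul_right T (show 1 ≤ 3 * (q + 5) ^ 2 by nlinarith)]
        _ = _ := by ring
    · intro V ls _ hV
      by_cases hls : (∀ x y : Fin (r + 1), x < y → ls x < ls y)
      · simp only [time_bind, time_test, val_test, decide_eq_true hls, if_true]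
        gcongr
        refine (forEach_time_measure List.length (g := g) (M := M)
          (T := 2 * (r + 1) + T) ?_ ?_ ?_).trans ?_
        · intro V ds _
          simpa using h V _ _
        · intro V ds _ hV
          simpa using hT V (List.ofFn ls) (List.ofFn ds) (by simpa using hr') (by simp) hV
        · refine le_trans ?_ hV
          gcongr
          exact length_words _ _
        · gcongr
          exact length_words _ _
      · simp only [time_bind, time_test, val_test, decide_eq_false hls]
        simp
    · have := outer r hr'
      have := (Nat.mul_le_mul_right (dom.length ^ (r + 1) * g) (hwn r)).trans this
      omega
  · have e5 : 1 ≤ N ^ q * (T + 1) := Nat.mul_pos (Nat.one_le_pow _ _ hN1) (by omega)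
    simp only [List.length_range]
    calc _ = 3 * (q + 5) ^ 2 * q * (N ^ q * (T + 1)) + (q + 1) := by ring
      _ ≤ 3 * (q + 5) ^ 2 * q * (N ^ q * (T + 1)) + (q + 1) * (N ^ q * (T + 1)) := by
          gcongr; exact Nat.le_mul_of_pos_right _ e5
      _ = (3 * (q + 5) ^ 2 * q + (q + 1)) * (N ^ q * (T + 1)) := by ring
      _ ≤ (4 * (q + 5) ^ 3) * (N ^ q * (T + 1)) := by gcongr; nlinarith [Nat.zero_le (q^3), Nat.zero_le (q^2)]
      _ = _ := by ring

end AlgorithmLoops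

/-! ## Representations -/

section Representations

variable {k n : ℕ} {A : Type u} {φ : (Fin k → A) → A}

/-- `U` is a representation of order `k - 1` of `R`: it is a part of `R` that witnesses the same
triples `(i, a, b)` with a minority pair `{a, b}` and has the same projections to at most `k - 1`
coordinates. -/
structure IsRep (φ : (Fin k → A) → A) (U R : Set (Fin n → A)) : Prop where
  subset : U ⊆ R
  witness : ∀ i a b, MinorityPair φ a b → ∀ t ∈ R, ∀ t' ∈ R, Witnesses t t' i a b →
    ∃ u ∈ U, ∃ u' ∈ U, Witnesses u u' i a b
  proj : ∀ I : Finset (Fin n), I.Nonempty → I.card ≤ k - 1 → ∀ t ∈ R, ∃ u ∈ U, ∀ l ∈ I, u l = t l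

theorem firstRest_self (a : A) : (firstRest a a : Fin k → A) = fun _ => a := by
  funext p
  simp [firstRest]

/-- The pair {a, a} falls under one of the two cases, and either yields the identity. -/
theorem IsGMM.idempotent (hφ : IsGMM φ) (a : A) : φ (fun _ => a) = a := by
  have hk : 0 < k := by have := hφ.1; omega
  rcases hφ.2 a a with h | h
  · simpa using h a (by simp) a (by simp) ⟨0, hk⟩
  · simpa only [firstRest_self] using (h a (by simp) a (by simp)).1

theorem ActsAsMajority.firstRest {a b : A} (hk : 3 ≤ k) (h : ActsAsMajority φ a b) :
    φ (firstRest a b) = b := by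
  have := h a (by simp) b (by simp) ⟨0, by omega⟩
  simp only [Fin.ext_iff] at this
  exact this

theorem ActsAsMajority.restLast {a b : A} (hk : 3 ≤ k) (h : ActsAsMajority φ a b) :
    φ (restLast a b) = a := by
  have := h b (by simp) a (by simp) ⟨k - 1, by omega⟩
  have he : (GMM.restLast a b : Fin k → A) =
      fun q => if q = ⟨k - 1, by omega⟩ then b else a := by
    funext q
    simp only [GMM.restLast, Fin.ext_iff]
    congr 1
    exact propext ⟨fun _ => by omega, fun _ => by omega⟩
  rw [he, this]

theorem firstMidLast_self (x y : A) : (firstMidLast x y y : Fin k → A) = firstRest x y := by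
  funext p
  simp [firstMidLast, firstRest]

theorem firstMidLast_eq_restLast (hk : 3 ≤ k) (x y : A) :
    (firstMidLast x x y : Fin k → A) = restLast x y := by
  funext p
  simp only [firstMidLast, restLast]
  split_ifs <;> first | rfl | omega

theorem applyTuples_firstRest (s t : Fin n → A) (l : Fin n) :
    applyTuples φ (firstRest s t) l = φ (firstRest (s l) (t l)) := by
  unfold applyTuples
  congr 1
  funext p
  simp only [firstRest]
  split_ifs <;> rfl

theorem applyTuples_restLast (s t : Fin n → A) (l : Fin n) :
    applyTuples φ (restLast s t) l = φ (restLast (s l) (t l)) := by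
  unfold applyTuples
  congr 1
  funext p
  simp only [restLast]
  split_ifs <;> rfl

theorem applyTuples_firstMidLast (s t t' : Fin n → A) (l : Fin n) :
    applyTuples φ (firstMidLast s t t') l = φ (firstMidLast (s l) (t l) (t' l)) := by
  unfold applyTuples
  congr 1
  funext p
  simp only [firstMidLast]
  split_ifs <;> rfl

/-- The tuple `φ(t₁, …, t₁, φ(t₁, t₂, …, t₂, t₃))`. -/
def switch (φ : (Fin k → A) → A) (t₁ t₂ t₃ : Fin n → A) : Fin n → A :=
  applyTuples φ (restLast t₁ (applyTuples φ (firstMidLast t₁ t₂ t₃)))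

/-- Witnesses of a minority triple can be moved to any tuple with the right entry. -/
theorem witnesses_switch (hφ : IsGMM φ) {t₁ t₂ t₃ : Fin n → A} {i : Fin n} {a b : A}
    (hab : MinorityPair φ a b) (h₁ : t₁ i = a) (h : Witnesses t₂ t₃ i a b) :
    Witnesses t₁ (switch φ t₁ t₂ t₃) i a b := by
  refine ⟨fun l hl => ?_, h₁, ?_⟩
  -- Before `i` the tuples `t₂` and `t₃` agree, so with x, y the entries of `t₁`, `t₂` the inner
  -- term is φ(x, y, …, y). On a majority pair this is y, and φ(x, …, x, y) = x; on a minority pair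
  -- it is already x, and φ(x, …, x) = x.
  · rw [switch, applyTuples_restLast, applyTuples_firstMidLast, ← h.1 l hl, firstMidLast_self]
    rcases hφ.2 (t₁ l) (t₂ l) with hm | hm
    · rw [hm.firstRest hφ.1, hm.restLast hφ.1]
    · rw [(hm (t₁ l) (by simp) (t₂ l) (by simp)).1,
        (hm (t₁ l) (by simp) (t₁ l) (by simp)).2]
  -- At `i` the inner term is φ(a, …, a, b) = b, and the outer term then has the same form.
  · have hb := (hab.2 b (by simp) a (by simp)).2
    rw [switch, applyTuples_restLast, applyTuples_firstMidLast, h₁, h.2.1, h.2.2,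
      firstMidLast_eq_restLast hφ.1, hb, hb]

theorem Invariant.restLast_mem {R : Set (Fin n → A)} (hR : Invariant φ R) {s t : Fin n → A}
    (hs : s ∈ R) (ht : t ∈ R) : applyTuples φ (restLast s t) ∈ R :=
  hR _ fun p => by simp only [restLast]; split_ifs <;> assumption

theorem Invariant.firstRest_mem {R : Set (Fin n → A)} (hR : Invariant φ R) {s t : Fin n → A}
    (hs : s ∈ R) (ht : t ∈ R) : applyTuples φ (firstRest s t) ∈ R :=
  hR _ fun p => by simp only [firstRest]; split_ifs <;> assumption

theorem Invariant.switch_mem {R : Set (Fin n → A)} (hR : Invariant φ R) {t₁ t₂ t₃ : Fin n → A}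
    (h₁ : t₁ ∈ R) (h₂ : t₂ ∈ R) (h₃ : t₃ ∈ R) : switch φ t₁ t₂ t₃ ∈ R :=
  hR.restLast_mem h₁ <| hR _ fun p => by simp only [firstMidLast]; split_ifs <;> assumption

theorem Invariant.inter {R S : Set (Fin n → A)} (hR : Invariant φ R) (hS : Invariant φ S) :
    Invariant φ (R ∩ S) :=
  fun ts h => ⟨hR ts fun x => (h x).1, hS ts fun x => (h x).2⟩

/-- By idempotence one-element relations are invariant, so fixing values of coordinates stays within
the invariant relations. -/
theorem invariant_coord (hφ : IsGMM φ) (c : Fin n) (e : A) :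
    Invariant φ {t : Fin n → A | t c = e} := by
  intro ts h
  have : (fun x => ts x c) = fun _ => e := funext h
  simp only [Set.mem_ofPred_eq, applyTuples, this, hφ.idempotent]

/-! ### Representations generate their relations -/

/-- Correcting an entry of `s` to that of `t` if the two entries form a majority pair. -/
theorem exists_agree_of_majority (hφ : IsGMM φ) {U R G : Set (Fin n → A)} (hU : IsRep φ U R)
    (hG : Invariant φ G) (hUG : U ⊆ G) {s t : Fin n → A} (ht : t ∈ R) (hs : s ∈ G) {i : Fin n}
    (hst : ∀ l < i, s l = t l) (hm : ActsAsMajority φ (s i) (t i)) (I : Finset (Fin n))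
    (hI : ∀ l ∈ I, l < i) : ∃ u ∈ G, (∀ l ∈ I, u l = t l) ∧ u i = t i := by
  have hk := hφ.1
  induction hc : I.card using Nat.strong_induction_on generalizing I with
  | _ c ih =>
  subst hc
  -- Together with `i` such a set has at most k - 1 elements, which is the order of the
  -- representation.
  by_cases hsmall : I.card ≤ k - 2
  · obtain ⟨u, hu, hut⟩ := hU.proj (insert i I) (by simp)
      ((Finset.card_insert_le _ _).trans (by omega)) t ht
    exact ⟨u, hUG hu, fun l hl => hut l (by simp [hl]), hut i (by simp)⟩
  -- Now `I` has at least k - 1 elements. Dropping one of k - 1 distinct elements at a time yields,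
  -- by induction, tuples `u j` that are right at `i` and wrong on `I` at most at `f j`.
  obtain ⟨f⟩ : Nonempty (Fin (k - 1) ↪ I) :=
    Function.Embedding.nonempty_of_card_le (by simp; omega)
  have hex : ∀ j, ∃ u ∈ G, (∀ l ∈ I.erase (f j), u l = t l) ∧ u i = t i := fun j =>
    ih _ (Finset.card_erase_lt_of_mem (f j).2) (I.erase (f j))
      (fun l hl => hI l (Finset.mem_of_mem_erase hl)) rfl
  choose u huG hut hui using hex
  have hut' : ∀ j, ∀ l ∈ I, l ≠ f j → u j l = t l := fun j l hl hne => hut j l (by simp [hne, hl])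
  by_cases hmin : ∃ j, ActsAsMinority φ (u j (f j)) (t (f j))
  · obtain ⟨j, hj⟩ := hmin
    -- The tuple φ(s, u_j, …, u_j) works: at `f j` the entry of `s` is right and a minority pair
    -- returns the first argument; at `i` the entry of `u j` is right and a majority pair returns
    -- it; at the other coordinates in `I` all arguments agree.
    refine ⟨_, hG.firstRest_mem hs (huG j), fun l hl => ?_, ?_⟩
    · rw [applyTuples_firstRest, hst l (hI l hl)]
      by_cases hlj : l = f j
      · subst hlj
        exact (hj _ (by simp) _ (by simp)).1
      · rw [hut' j l hl hlj]
        simpa only [firstRest_self] using hφ.idempotent (t l)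
    · rw [applyTuples_firstRest, hui]
      exact hm.firstRest hk
  · have hmaj : ∀ j, ActsAsMajority φ (u j (f j)) (t (f j)) := fun j =>
      (hφ.2 _ _).resolve_right fun h => hmin ⟨j, h⟩
    -- The k - 1 tuples `u j`, followed by `s` as last argument: at `f j` only argument number j can
    -- be wrong, at `i` only `s` is, and the majority rule overrules a single deviating argument.
    refine ⟨applyTuples φ fun p => if h : p.val < k - 1 then u ⟨p.val, h⟩ else s,
      hG _ fun p => ?_, fun l hl => ?_, ?_⟩
    · split_ifs
      exacts [huG _, hs]
    · by_cases hlf : ∃ j, l = f j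
      · obtain ⟨j, rfl⟩ := hlf
        have := hmaj j (u j (f j)) (by simp) (t (f j)) (by simp) ⟨j.val, by omega⟩
        refine Eq.trans ?_ this
        unfold applyTuples
        congr 1
        funext q
        by_cases hq : q.val < k - 1
        · by_cases hqj : q.val = j.val
          · have : (⟨q.val, hq⟩ : Fin (k - 1)) = j := Fin.ext hqj
            simp [Fin.ext_iff, hqj]
          · have hne : (f j : Fin n) ≠ f ⟨q.val, hq⟩ := fun h =>
              hqj (congrArg Fin.val (f.injective (Subtype.ext h))).symm
            simp [hq, Fin.ext_iff, hqj, hut' ⟨q.val, hq⟩ _ (f j).2 hne]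
        · have hqj : q.val ≠ j.val := by have := j.2; omega
          simp [hq, Fin.ext_iff, hqj, hst _ (hI _ (f j).2)]
      · refine Eq.trans ?_ (hφ.idempotent (t l))
        unfold applyTuples
        congr 1
        funext q
        by_cases hq : q.val < k - 1
        · simp [hq, hut' ⟨q.val, hq⟩ l hl fun h => hlf ⟨_, h⟩]
        · simp [hq, hst l (hI l hl)]
    · have := hm (s i) (by simp) (t i) (by simp) ⟨k - 1, by omega⟩
      refine Eq.trans ?_ this
      unfold applyTuples
      congr 1
      funext q
      by_cases hq : q.val < k - 1
      · have : q.val ≠ k - 1 := by omega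
        simp [hq, hui, Fin.ext_iff, this]
      · have : q.val = k - 1 := by omega
        simp [this, Fin.ext_iff]

/-- A representation of an invariant relation generates the relation. -/
theorem IsRep.subset_of_invariant (hφ : IsGMM φ) (hn : 0 < n) {U R G : Set (Fin n → A)}
    (hU : IsRep φ U R) (hR : Invariant φ R) (hG : Invariant φ G) (hUG : U ⊆ G) : R ⊆ G := by
  have hk := hφ.1
  -- The approximations must stay in `R`, because `U` is known to witness only those triples that
  -- are witnessed by tuples of `R`.
  have hH : Invariant φ (G ∩ R) := hG.inter hR
  have hUH : U ⊆ G ∩ R := fun u hu => ⟨hUG hu, hU.subset hu⟩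
  intro t ht
  have key : ∀ i ≤ n, ∃ s ∈ G ∩ R, ∀ l : Fin n, l.val < i → s l = t l := by
    intro i
    induction i with
    | zero =>
      intro _
      -- Any tuple will do at the start; the projection to one coordinate supplies it, whence the
      -- need for n > 0.
      obtain ⟨u, hu, -⟩ := hU.proj {⟨0, hn⟩} (by simp) (by simp; omega) t ht
      exact ⟨u, hUH hu, by simp⟩
    | succ i ih =>
      intro hi
      obtain ⟨s, hs, hst⟩ := ih (by omega)
      set c : Fin n := ⟨i, hi⟩ with hc
      have hst' : ∀ l < c, s l = t l := fun l hl => hst l hl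
      suffices h : ∃ u ∈ G ∩ R, (∀ l < c, u l = t l) ∧ u c = t c by
        obtain ⟨u, hu, h1, h2⟩ := h
        refine ⟨u, hu, fun l hl => ?_⟩
        rcases Nat.lt_succ_iff_lt_or_eq.1 hl with hl | hl
        · exact h1 l hl
        · have : l = c := Fin.ext hl
          rw [this, h2]
      by_cases heq : s c = t c
      · exact ⟨s, hs, hst', heq⟩
      rcases hφ.2 (s c) (t c) with hm | hm
      · obtain ⟨u, hu, h1, h2⟩ := exists_agree_of_majority hφ hU hH hUH ht hs hst' hm
          (Finset.univ.filter (· < c)) (by simp)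
        exact ⟨u, hu, fun l hl => h1 l (by simp [hl]), h2⟩
      · have hmin : MinorityPair φ (s c) (t c) := ⟨heq, hm⟩
        -- The tuples `s` and `t` themselves witness this minority triple in `R`, hence so do two
        -- tuples of `U`.
        obtain ⟨t₂, h₂, t₃, h₃, hw⟩ := hU.witness c _ _ hmin s hs.2 t ht ⟨hst', rfl, rfl⟩
        have hsw := witnesses_switch hφ hmin rfl hw
        exact ⟨_, hH.switch_mem hs (hUH h₂) (hUH h₃),
          fun l hl => (hsw.1 l hl).symm.trans (hst' l hl), hsw.2.2⟩
  obtain ⟨s, hs, hst⟩ := key n le_rfl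
  have : s = t := funext fun l => hst l l.2
  exact this ▸ hs.1

end Representations

/-! ## Correctness of the procedures -/

section Correctness

variable {k n : ℕ} {A : Type u} [DecidableEq A] {φ : (Fin k → A) → A}

/-! ### Correctness of `Nonempty` -/

theorem newTuple_eq_none {is : List (Fin n)} {U : List (Fin n → A)}
    (h : (newTuple φ is U).val = none) (ts : Fin k → Fin n → A) (hts : ∀ x, ts x ∈ U) :
    ∃ u ∈ U, is.map (applyTuples φ ts) = is.map u := by
  have := findFirst_eq_none h ts (mem_words.2 hts)
  simp only [existsIn_val, applyT, val_bind, val_pay, val_ret] at this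
  simpa using this

theorem newTuple_eq_some {is : List (Fin n)} {U : List (Fin n → A)} {t : Fin n → A}
    (h : (newTuple φ is U).val = some t) :
    (∃ ts : Fin k → Fin n → A, (∀ x, ts x ∈ U) ∧ t = applyTuples φ ts) ∧
      ∀ u ∈ U, is.map t ≠ is.map u := by
  obtain ⟨ts, hts, h⟩ := findFirst_eq_some h
  simp only [applyT, val_bind, val_pay, val_ret, existsIn_val] at h
  split_ifs at h with h'
  obtain rfl := Option.some.inj h
  exact ⟨⟨ts, mem_words.1 hts, rfl⟩, by simpa using h'⟩

variable [Fintype A]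

theorem grow_of_none {is : List (Fin n)} {U : List (Fin n → A)}
    (h : (newTuple φ is U).val = none) : grow φ is U = ⟨U, (newTuple φ is U).time + 1⟩ := by
  rw [grow]
  split
  · rfl
  · simp_all

theorem grow_of_some {is : List (Fin n)} {U : List (Fin n → A)} {t : Fin n → A}
    (h : (newTuple φ is U).val = some t) :
    grow φ is U = ⟨(grow φ is (t :: U)).val,
      (newTuple φ is U).time + 1 + (grow φ is (t :: U)).time⟩ := by
  rw [grow]
  split
  · simp_all
  · rename_i t' h'
    obtain rfl : t = t' := Option.some.inj (h.symm.trans h')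
    rfl

/-- Induction along the loop of `grow`. -/
theorem grow_induction {is : List (Fin n)} {motive : List (Fin n → A) → Prop}
    (none : ∀ U, (newTuple φ is U).val = none → motive U)
    (some : ∀ U t, (newTuple φ is U).val = some t → motive (t :: U) → motive U)
    (U : List (Fin n → A)) : motive U := by
  induction hc : (Finset.univ.filter fun t : Fin n → A => t ∉ U).card using
    Nat.strong_induction_on generalizing U with
  | _ c ih =>
  subst hc
  cases h : (newTuple φ is U).val with
  | none => exact none U h
  | some t =>
    refine some U t h (ih _ ?_ _ rfl)
    have hnew := notMem_of_newTuple h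
    apply Finset.card_lt_card
    rw [Finset.ssubset_iff_of_subset]
    · exact ⟨t, by simpa using hnew, by simp⟩
    · intro u hu
      simp only [List.mem_cons, not_or, Finset.mem_filter, Finset.mem_univ, true_and] at hu ⊢
      exact hu.2

theorem grow_subset {is : List (Fin n)} {R : Set (Fin n → A)} (hR : Invariant φ R)
    {U : List (Fin n → A)} (hU : ∀ t ∈ U, t ∈ R) : ∀ t ∈ (grow φ is U).val, t ∈ R := by
  induction U using grow_induction (φ := φ) (is := is) with
  | none U h => rwa [grow_of_none h]
  | some U t h ih =>
    rw [grow_of_some h]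
    obtain ⟨⟨ts, hts, rfl⟩, -⟩ := newTuple_eq_some h
    refine ih ?_
    simpa using ⟨hR ts fun x => hU _ (hts x), hU⟩

theorem subset_grow {is : List (Fin n)} {U : List (Fin n → A)} :
    ∀ t ∈ U, t ∈ (grow φ is U).val := by
  induction U using grow_induction (φ := φ) (is := is) with
  | none U h => simp [grow_of_none h]
  | some U t h ih =>
    rw [grow_of_some h]
    exact fun u hu => ih u (by simp [hu])

theorem grow_closed {is : List (Fin n)} {U : List (Fin n → A)} (ts : Fin k → Fin n → A)
    (hts : ∀ x, ts x ∈ (grow φ is U).val) :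
    ∃ u ∈ (grow φ is U).val, is.map (applyTuples φ ts) = is.map u := by
  induction U using grow_induction (φ := φ) (is := is) with
  | none U h =>
    rw [grow_of_none h] at hts ⊢
    exact newTuple_eq_none h ts hts
  | some U t h ih =>
    rw [grow_of_some h] at hts ⊢
    exact ih hts

/-- The tuples whose projection occurs in the grown list form an invariant relation: under φ each
argument may be replaced by a list member with the same projection, and the loop stops only when the
projection of the result is present. This relation contains `U`, hence all of `R`, although most of
`R` is never generated. -/
theorem exists_mem_grow (hφ : IsGMM φ) (hn : 0 < n) {is : List (Fin n)} {R : Set (Fin n → A)}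
    (hR : Invariant φ R) {U : List (Fin n → A)} (hU : IsRep φ {t | t ∈ U} R) {t : Fin n → A}
    (ht : t ∈ R) : ∃ u ∈ (grow φ is U).val, is.map t = is.map u := by
  refine hU.subset_of_invariant hφ hn hR (G := {t | ∃ u ∈ (grow φ is U).val, is.map t = is.map u})
    ?_ (fun u hu => ⟨u, subset_grow u hu, rfl⟩) ht
  intro ts hts
  choose us hus hmap using hts
  obtain ⟨u, hu, h⟩ := grow_closed us hus
  refine ⟨u, hu, Eq.trans ?_ h⟩
  rw [List.map_inj_left]
  intro l hl
  unfold applyTuples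
  congr 1
  funext x
  exact List.map_inj_left.1 (hmap x) l hl

theorem nonemptyProc_some {R : Set (Fin n → A)} (hR : Invariant φ R) {U : List (Fin n → A)}
    (hU : ∀ t ∈ U, t ∈ R) {is : List (Fin n)} {S : List (List A)} {t : Fin n → A}
    (h : (nonemptyProc φ U is S).val = some t) : t ∈ R ∧ is.map t ∈ S := by
  obtain ⟨u, hu, h⟩ := findFirst_eq_some h
  simp only [val_pay, val_bind, existsIn_val, val_ret, val_test] at h
  split_ifs at h with h'
  obtain rfl := Option.some.inj h
  exact ⟨grow_subset hR hU _ hu, by simpa using h'⟩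

theorem nonemptyProc_none (hφ : IsGMM φ) (hn : 0 < n) {R : Set (Fin n → A)}
    (hR : Invariant φ R) {U : List (Fin n → A)} (hU : IsRep φ {t | t ∈ U} R) {is : List (Fin n)}
    {S : List (List A)} (h : (nonemptyProc φ U is S).val = none) : ∀ t ∈ R, is.map t ∉ S := by
  intro t ht hS
  obtain ⟨u, hu, hmap⟩ := exists_mem_grow hφ hn (is := is) hR hU ht
  have := findFirst_eq_none h u hu
  simp [existsIn_val, ← hmap, hS] at this

theorem exists_nonemptyProc_eq_some (hφ : IsGMM φ) (hn : 0 < n) {R : Set (Fin n → A)}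
    (hR : Invariant φ R) {U : List (Fin n → A)} (hU : IsRep φ {t | t ∈ U} R) {is : List (Fin n)}
    {S : List (List A)} {t : Fin n → A} (ht : t ∈ R) (hS : is.map t ∈ S) :
    ∃ u, (nonemptyProc φ U is S).val = some u := by
  cases h : (nonemptyProc φ U is S).val with
  | none => exact absurd hS (nonemptyProc_none hφ hn hR hU h t ht)
  | some u => exact ⟨u, rfl⟩

omit [Fintype A] in
theorem findWitness_some {U : List (Fin n → A)} {i : Fin n} {a b : A}
    {t t' : Fin n → A} (h : (findWitness U i a b).val = some (t, t')) :
    t ∈ U ∧ t' ∈ U ∧ Witnesses t t' i a b := by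
  obtain ⟨u, hu, h⟩ := findFirst_eq_some h
  obtain ⟨u', hu', h⟩ := findFirst_eq_some h
  simp only [val_bind, val_ret, val_test, decide_eq_true_eq] at h
  split_ifs at h with h'
  cases h
  exact ⟨hu, hu', h'⟩

omit [Fintype A] in
theorem exists_findWitness_eq_some {U : List (Fin n → A)} {i : Fin n} {a b : A}
    {t t' : Fin n → A} (ht : t ∈ U) (ht' : t' ∈ U) (h : Witnesses t t' i a b) :
    ∃ p, (findWitness U i a b).val = some p := by
  cases h' : (findWitness U i a b).val with
  | none =>
    have := findFirst_eq_none (findFirst_eq_none h' t ht) t' ht'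
    simp [h] at this
  | some p => exact ⟨p, rfl⟩

omit [DecidableEq A] [Fintype A] in
-- Links the coordinate sets in `IsRep` to the increasing sequences over which the loops run; r + 1
-- is the number of coordinates.
theorem exists_ofFn_of_finset {I : Finset (Fin n)} (hI : I.Nonempty) (hIk : I.card ≤ k - 1) :
    ∃ r < k - 1, ∃ ls : Fin (r + 1) → Fin n, StrictMono ls ∧ ∀ l, l ∈ I ↔ ∃ x, ls x = l := by
  have hpos := hI.card_pos
  have hc : I.card = (I.card - 1) + 1 := by omega
  refine ⟨I.card - 1, by omega, I.orderEmbOfFin hc, (I.orderEmbOfFin hc).strictMono, fun l => ?_⟩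
  rw [← Set.mem_range, Finset.range_orderEmbOfFin, Finset.mem_coe]

/-! ### Correctness of `Fix-values` -/

theorem mem_fixStep {dom : List A} (hdom : ∀ a, a ∈ dom) {U : List (Fin n → A)} {c : Fin n} {e : A}
    {t : Fin n → A} : t ∈ (fixStep φ dom U c e).val ↔
      (∃ i a b, MinorityPair φ a b ∧ ∃ t₁ t₂ t₃,
        (nonemptyProc φ U [c, i] [[e, a]]).val = some t₁ ∧
        (findWitness U i a b).val = some (t₂, t₃) ∧ c < i ∧ (t = t₁ ∨ t = switch φ t₁ t₂ t₃)) ∨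
      ∃ r < k - 1, ∃ (ls : Fin (r + 1) → Fin n) (ds : Fin (r + 1) → A), StrictMono ls ∧
        (nonemptyProc φ U (List.ofFn ls ++ [c]) [List.ofFn ds ++ [e]]).val = some t := by
  simp only [fixStep, val_bind]
  rw [mem_forSubtuples (F := fun ls ds t =>
    (nonemptyProc φ U (ls ++ [c]) [ds ++ [e]]).val = some t) hdom,
    mem_forMinority (F := fun i a b t => ∃ t₁ t₂ t₃,
        (nonemptyProc φ U [c, i] [[e, a]]).val = some t₁ ∧
        (findWitness U i a b).val = some (t₂, t₃) ∧ c < i ∧ (t = t₁ ∨ t = switch φ t₁ t₂ t₃)) hdom]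
  · simp
  · intro V i a b t _
    cases h₁ : (nonemptyProc φ U [c, i] [[e, a]]).val with
    | none => simp [h₁]
    | some t₁ =>
      cases h₂ : (findWitness U i a b).val with
      | none => simp [h₁, h₂]
      | some p =>
        obtain ⟨t₂, t₃⟩ := p
        by_cases hci : c < i
        · simp [h₁, h₂, hci, mem_insertT, or_assoc, applyT, switch]
        · simp [h₁, h₂, hci]
  · intro V ls ds t
    cases h : (nonemptyProc φ U (ls ++ [c]) [ds ++ [e]]).val with
    | none => simp [h]
    | some t₆ => simp [h, mem_insertT, eq_comm]

/-- All tuples of `R` agree before `c`, and those of the restricted relation also at `c`, so the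
latter can witness a minority triple only at some i > c and the test `c < i` loses nothing.
Witnesses found in `U` need not have the entry `e` at `c`, but moving them to `t₁` yields a pair
that agrees with `t₁` before i, in particular at `c`. -/
theorem isRep_fixStep (hφ : IsGMM φ) (hn : 0 < n) {dom : List A} (hdom : ∀ a, a ∈ dom)
    {R : Set (Fin n → A)} (hR : Invariant φ R) {U : List (Fin n → A)}
    (hU : IsRep φ {t | t ∈ U} R) {c : Fin n} {e : A}
    (hc : ∀ t ∈ R, ∀ t' ∈ R, ∀ l < c, t l = t' l) :
    IsRep φ {t | t ∈ (fixStep φ dom U c e).val} (R ∩ {t | t c = e}) := by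
  have hRc := hR.inter (invariant_coord hφ c e)
  refine ⟨fun t ht => ?_, ?_, ?_⟩
  · rcases (mem_fixStep hdom).1 ht with ⟨i, a, b, hab, t₁, t₂, t₃, h₁, h₂, hci, h⟩ |
      ⟨r, -, ls, ds, -, h⟩
    · obtain ⟨ht₁, hS⟩ := nonemptyProc_some hR hU.subset h₁
      obtain ⟨ht₂, ht₃, hw⟩ := findWitness_some h₂
      simp only [List.map_cons, List.map_nil, List.mem_singleton, List.cons.injEq, and_true] at hS
      rcases h with rfl | rfl
      · exact ⟨ht₁, hS.1⟩
      · exact ⟨hR.switch_mem ht₁ (hU.subset ht₂) (hU.subset ht₃),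
          ((witnesses_switch hφ hab hS.2 hw).1 c hci).symm.trans hS.1⟩
    · obtain ⟨ht, hS⟩ := nonemptyProc_some hR hU.subset h
      simp only [List.map_append, List.mem_singleton] at hS
      have := (List.append_inj' hS (by simp)).2
      simp only [List.map_cons, List.map_nil, List.cons.injEq, and_true] at this
      exact ⟨ht, this⟩
  · intro i a b hab t ht t' ht' hw
    have hci : c < i := by
      rcases lt_trichotomy c i with h | rfl | h
      · exact h
      · exact absurd (hw.2.1.symm.trans (ht.2.trans (ht'.2.symm.trans hw.2.2))) hab.1
      · exact absurd (hw.2.1.symm.trans ((hc t ht.1 t' ht'.1 i h).trans hw.2.2)) hab.1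
    obtain ⟨t₁, h₁⟩ := exists_nonemptyProc_eq_some hφ hn hR hU (is := [c, i]) (S := [[e, a]]) ht.1
      (by simpa using ⟨ht.2, hw.2.1⟩)
    obtain ⟨u, hu, u', hu', hw'⟩ := hU.witness i a b hab t ht.1 t' ht'.1 hw
    obtain ⟨⟨t₂, t₃⟩, h₂⟩ := exists_findWitness_eq_some hu hu' hw'
    obtain ⟨ht₁, hS⟩ := nonemptyProc_some hR hU.subset h₁
    simp only [List.map_cons, List.map_nil, List.mem_singleton, List.cons.injEq, and_true] at hS
    refine ⟨t₁, (mem_fixStep hdom).2 (Or.inl ⟨i, a, b, hab, t₁, t₂, t₃, h₁, h₂, hci, Or.inl rfl⟩),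
      switch φ t₁ t₂ t₃,
      (mem_fixStep hdom).2 (Or.inl ⟨i, a, b, hab, t₁, t₂, t₃, h₁, h₂, hci, Or.inr rfl⟩),
      witnesses_switch hφ hab hS.2 (findWitness_some h₂).2.2⟩
  · intro I hI hIk t ht
    obtain ⟨r, hr, ls, hls, hmem⟩ := exists_ofFn_of_finset (k := k) hI hIk
    have hS : (List.ofFn ls ++ [c]).map t ∈ [List.ofFn (fun x => t (ls x)) ++ [e]] := by
      have : t c = e := ht.2
      simp [List.map_ofFn, Function.comp_def, this]
    obtain ⟨u, hu⟩ := exists_nonemptyProc_eq_some hφ hn hR hU ht.1 hS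
    refine ⟨u, (mem_fixStep hdom).2 (Or.inr ⟨r, hr, ls, _, hls, hu⟩), fun l hl => ?_⟩
    obtain ⟨x, rfl⟩ := (hmem l).1 hl
    have h2 := (nonemptyProc_some hR hU.subset hu).2
    simp only [List.map_append, List.mem_singleton] at h2
    have h3 := (List.append_inj' h2 (by simp)).1
    rw [List.map_ofFn] at h3
    exact congrFun (List.ofFn_injective h3) x

/-- The loop invariant of `Fix-values`. -/
theorem isRep_fixValues_step (hφ : IsGMM φ) (hn : 0 < n) {dom : List A} (hdom : ∀ a, a ∈ dom)
    {R : Set (Fin n → A)} (hR : Invariant φ R) {U : List (Fin n → A)} {s : Fin n → A} {j : ℕ}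
    (hj : j < n) (hU : IsRep φ {t | t ∈ U} (R ∩ {t | ∀ l : Fin n, l.val < j → t l = s l})) :
    IsRep φ {t | t ∈ (fixStep φ dom U ⟨j, hj⟩ (s ⟨j, hj⟩)).val}
      (R ∩ {t | ∀ l : Fin n, l.val < j + 1 → t l = s l}) := by
  have hinv : Invariant φ {t : Fin n → A | ∀ l : Fin n, l.val < j → t l = s l} :=
    fun ts h l hl => invariant_coord hφ l (s l) ts fun x => h x l hl
  convert isRep_fixStep hφ hn hdom (hR.inter hinv) hU (c := ⟨j, hj⟩) (e := s ⟨j, hj⟩) ?_ using 1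
  · rw [Set.inter_assoc]
    congr 1
    ext t
    constructor
    · exact fun h => ⟨fun l hl => h l (by omega), h _ (Nat.lt_succ_self j)⟩
    · rintro ⟨h1, h2⟩ l hl
      rcases Nat.lt_succ_iff_lt_or_eq.1 hl with hl | hl
      · exact h1 l hl
      · obtain rfl : l = ⟨j, hj⟩ := Fin.ext hl
        exact h2
  · exact fun t ht t' ht' l hl => (ht.2 l hl).trans (ht'.2 l hl).symm

omit [DecidableEq A] [Fintype A] in
-- `zip` stops with the shorter list, so the loop of `Fix-values` visits just the coordinates before
-- `i`, and its iteration number j treats coordinate j.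
theorem zip_take_getElem (s : Fin n → A) (i : Fin n) {j : ℕ}
    (hj : j < ((List.finRange n).zip (((List.finRange n).take i.val).map s)).length) :
    ∃ hj' : j < n, ((List.finRange n).zip (((List.finRange n).take i.val).map s))[j] =
      (⟨j, hj'⟩, s ⟨j, hj'⟩) := by
  have : j < n := by simp at hj; omega
  exact ⟨this, by simp⟩

omit [DecidableEq A] [Fintype A] in
theorem length_zip_take (s : Fin n → A) (i : Fin n) :
    ((List.finRange n).zip (((List.finRange n).take i.val).map s)).length = i.val := by
  simp

theorem isRep_fixValues (hφ : IsGMM φ) (hn : 0 < n) {dom : List A} (hdom : ∀ a, a ∈ dom)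
    {R : Set (Fin n → A)} (hR : Invariant φ R) {U : List (Fin n → A)}
    (hU : IsRep φ {t | t ∈ U} R) (s : Fin n → A) (i : Fin n) :
    IsRep φ {t | t ∈ (fixValues φ dom U (((List.finRange n).take i.val).map s)).val}
      (R ∩ {t | ∀ l < i, t l = s l}) := by
  have := forEach_invariant
    (body := fun U (ce : Fin n × A) => fixStep φ dom U ce.1 ce.2)
    (l := (List.finRange n).zip (((List.finRange n).take i.val).map s)) (s := U)
    (fun j V => IsRep φ {t | t ∈ V} (R ∩ {t | ∀ l : Fin n, l.val < j → t l = s l})) ?_ ?_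
  · rwa [length_zip_take] at this
  · intro j hj V hV
    obtain ⟨hj', he⟩ := zip_take_getElem s i hj
    rw [he]
    exact isRep_fixValues_step hφ hn hdom hR hj' hV
  · simpa using hU

/-! ### Correctness of `Next-beta` -/

omit [DecidableEq A] [Fintype A] in
theorem mem_extendRel {S : List (List A)} {ds s : List A} :
    s ∈ (extendRel S ds).val ↔ ∃ s' ∈ S, s = s' ++ ds := by
  rw [extendRel, mem_forEach (F := fun s' s => s = s' ++ ds)]
  · simp
  · simp [or_comm]

omit [DecidableEq A] [Fintype A] in
theorem map_append_mem_extendRel {S : List (List A)} {ds : List A} {is ls : List (Fin n)}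
    (hlen : ls.length = ds.length) {t : Fin n → A} :
    (is ++ ls).map t ∈ (extendRel S ds).val ↔ is.map t ∈ S ∧ ls.map t = ds := by
  rw [mem_extendRel, List.map_append]
  constructor
  · rintro ⟨s', hs', h⟩
    obtain ⟨rfl, h2⟩ := List.append_inj' h (by simpa using hlen)
    exact ⟨hs', h2⟩
  · rintro ⟨h, rfl⟩
    exact ⟨_, h, rfl⟩

theorem mem_nextBeta {dom : List A} (hdom : ∀ a, a ∈ dom) {U : List (Fin n → A)}
    {is : List (Fin n)} {S : List (List A)} {t : Fin n → A} :
    t ∈ (nextBeta φ dom U is S).val ↔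
      (∃ i a b, MinorityPair φ a b ∧ ∃ t₁ t₂,
        (nonemptyProc φ U (is ++ [i]) (extendRel S [a]).val).val = some t₁ ∧
        (nonemptyProc φ (fixValues φ dom U (((List.finRange n).take i.val).map t₁)).val (is ++ [i])
          (extendRel S [b]).val).val = some t₂ ∧ (t = t₁ ∨ t = t₂)) ∨
      ∃ r < k - 1, ∃ (ls : Fin (r + 1) → Fin n) (ds : Fin (r + 1) → A), StrictMono ls ∧
        (nonemptyProc φ U (is ++ List.ofFn ls) (extendRel S (List.ofFn ds)).val).val = some t := by
  simp only [nextBeta, val_bind]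
  rw [mem_forSubtuples (F := fun ls ds t =>
    (nonemptyProc φ U (is ++ ls) (extendRel S ds).val).val = some t) hdom,
    mem_forMinority (F := fun i a b t => ∃ t₁ t₂,
        (nonemptyProc φ U (is ++ [i]) (extendRel S [a]).val).val = some t₁ ∧
        (nonemptyProc φ (fixValues φ dom U (((List.finRange n).take i.val).map t₁)).val (is ++ [i])
          (extendRel S [b]).val).val = some t₂ ∧ (t = t₁ ∨ t = t₂)) hdom]
  · simp
  · intro V i a b t _
    cases h₁ : (nonemptyProc φ U (is ++ [i]) (extendRel S [a]).val).val with
    | none => simp [h₁]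
    | some t₁ =>
      cases h₂ : (nonemptyProc φ (fixValues φ dom U (((List.finRange n).take i.val).map t₁)).val
          (is ++ [i]) (extendRel S [b]).val).val with
      | none => simp [-List.map_take, h₁, h₂]
      | some t₂ => simp [-List.map_take, h₁, h₂, mem_insertT, or_assoc]
  · intro V ls ds t
    cases h : (nonemptyProc φ U (is ++ ls) (extendRel S ds).val).val with
    | none => simp [h]
    | some t₃ => simp [h, mem_insertT, eq_comm]

/-- Let t, t' in the restricted relation witness (i, a, b). The tuple t₁ returned by the first
search need not be t, but `switch φ t₁ t t'` lies in the restricted relation, agrees with t₁ before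
i and has the entry b at i. Hence the second search, among the tuples with the same first entries as
t₁, succeeds, and whatever it returns forms a pair of witnesses with t₁. -/
theorem isRep_nextBeta (hφ : IsGMM φ) (hn : 0 < n) {dom : List A} (hdom : ∀ a, a ∈ dom)
    {R : Set (Fin n → A)} (hR : Invariant φ R) {U : List (Fin n → A)}
    (hU : IsRep φ {t | t ∈ U} R) {is : List (Fin n)} {S : List (List A)}
    (hS : Invariant φ {t : Fin n → A | is.map t ∈ S}) :
    IsRep φ {t | t ∈ (nextBeta φ dom U is S).val} (R ∩ {t | is.map t ∈ S}) := by
  have hfix : ∀ (s : Fin n → A) (i : Fin n), Invariant φ (R ∩ {t | ∀ l < i, t l = s l}) :=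
    fun s i => hR.inter fun ts h l hl => invariant_coord hφ l (s l) ts fun x => h x l hl
  have hone : ∀ {i : Fin n} {a : A} {t : Fin n → A},
      (is ++ [i]).map t ∈ (extendRel S [a]).val ↔ is.map t ∈ S ∧ t i = a := fun {i a t} => by
    simp [-List.map_append, map_append_mem_extendRel]
  refine ⟨fun t ht => ?_, ?_, ?_⟩
  · rcases (mem_nextBeta hdom).1 ht with ⟨i, a, b, hab, t₁, t₂, h₁, h₂, h⟩ | ⟨r, -, ls, ds, -, h⟩
    · have hF := isRep_fixValues hφ hn hdom hR hU t₁ i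
      have h₁ := nonemptyProc_some hR hU.subset h₁
      have h₂ := nonemptyProc_some (hfix t₁ i) hF.subset h₂
      rcases h with rfl | rfl
      · exact ⟨h₁.1, (hone.1 h₁.2).1⟩
      · exact ⟨h₂.1.1, (hone.1 h₂.2).1⟩
    · obtain ⟨ht, h⟩ := nonemptyProc_some hR hU.subset h
      exact ⟨ht, ((map_append_mem_extendRel (by simp)).1 h).1⟩
  · intro i a b hab t ht t' ht' hw
    obtain ⟨t₁, h₁⟩ := exists_nonemptyProc_eq_some hφ hn hR hU ht.1 (hone.2 ⟨ht.2, hw.2.1⟩)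
    have hF := isRep_fixValues hφ hn hdom hR hU t₁ i
    obtain ⟨hR₁, hS₁⟩ := nonemptyProc_some hR hU.subset h₁
    have hw₁ := witnesses_switch hφ hab (hone.1 hS₁).2 hw
    have hsw := (hR.inter hS).switch_mem ⟨hR₁, (hone.1 hS₁).1⟩ ht ht'
    obtain ⟨t₂, h₂⟩ := exists_nonemptyProc_eq_some hφ hn (hfix t₁ i) hF
      (t := switch φ t₁ t t') ⟨hsw.1, fun l hl => (hw₁.1 l hl).symm⟩ (hone.2 ⟨hsw.2, hw₁.2.2⟩)
    obtain ⟨hR₂, hS₂⟩ := nonemptyProc_some (hfix t₁ i) hF.subset h₂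
    exact ⟨t₁, (mem_nextBeta hdom).2 (Or.inl ⟨i, a, b, hab, t₁, t₂, h₁, h₂, Or.inl rfl⟩),
      t₂, (mem_nextBeta hdom).2 (Or.inl ⟨i, a, b, hab, t₁, t₂, h₁, h₂, Or.inr rfl⟩),
      fun l hl => (hR₂.2 l hl).symm, (hone.1 hS₁).2, (hone.1 hS₂).2⟩
  · intro I hI hIk t ht
    obtain ⟨r, hr, ls, hls, hmem⟩ := exists_ofFn_of_finset (k := k) hI hIk
    have hS' : (is ++ List.ofFn ls).map t ∈ (extendRel S (List.ofFn fun x => t (ls x))).val :=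
      (map_append_mem_extendRel (by simp)).2 ⟨ht.2, by simp [List.map_ofFn, Function.comp_def]⟩
    obtain ⟨u, hu⟩ := exists_nonemptyProc_eq_some hφ hn hR hU ht.1 hS'
    refine ⟨u, (mem_nextBeta hdom).2 (Or.inr ⟨r, hr, ls, _, hls, hu⟩), fun l hl => ?_⟩
    obtain ⟨x, rfl⟩ := (hmem l).1 hl
    have h2 := (nonemptyProc_some hR hU.subset hu).2
    have h3 := ((map_append_mem_extendRel (by simp)).1 h2).2
    rw [List.map_ofFn] at h3
    exact congrFun (List.ofFn_injective h3) x

/-! ### Correctness of `Next` -/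

omit [Fintype A] in
theorem mem_prefixRel {l : ℕ} {S : List (List A)} {s : List A} :
    s ∈ (prefixRel l S).val ↔ ∃ s' ∈ S, s = s'.take l := by
  rw [prefixRel, mem_forEach (F := fun s' s => s = s'.take l)]
  · simp
  · simp [mem_insertT]

/-- The tuples whose projections to the first `l` variables of the scope of a constraint are
projections of tuples of the constraint relation. -/
def Constraint.prefixSolutions (C : Constraint n A) (l : ℕ) : Set (Fin n → A) :=
  {t | ∃ u ∈ C.rel, ∀ x : Fin C.arity, x.val < l → t (C.scope x) = u x}

omit [DecidableEq A] [Fintype A] in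
-- Apply φ to tuples of the constraint relation that extend the given prefixes.
theorem Constraint.invariant_prefixSolutions {C : Constraint n A} (hC : Invariant φ C.rel) (l : ℕ) :
    Invariant φ (C.prefixSolutions l) := by
  intro ts hts
  choose us hus h using hts
  refine ⟨_, hC us hus, fun x hx => ?_⟩
  unfold applyTuples
  congr 1
  funext y
  exact h y x hx

omit [Fintype A] in
theorem Constraint.mem_prefixSolutions {C : Constraint n A} {l : ℕ} {t : Fin n → A} :
    t ∈ C.prefixSolutions l ↔
      ((List.ofFn C.scope).take l).map t ∈
        (prefixRel l (C.tuples.map fun t => List.ofFn t)).val := by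
  simp only [mem_prefixRel, List.mem_map, exists_exists_and_eq_and,
    Constraint.prefixSolutions, Constraint.rel, Set.mem_ofPred_eq]
  refine exists_congr fun u => and_congr_right fun _ => ?_
  rw [List.map_take, List.map_ofFn]
  constructor
  · intro h
    refine List.ext_getElem (by simp) fun j h1 h2 => ?_
    simp only [List.length_take, List.length_ofFn, lt_min_iff] at h1
    simpa using h ⟨j, h1.2⟩ h1.1
  · intro h x hx
    have := congrArg (fun s => s[x.val]?) h
    simpa [List.getElem?_take, hx] using this

/-- The loop invariant of `Next`. -/
theorem isRep_next_step (hφ : IsGMM φ) (hn : 0 < n) {dom : List A} (hdom : ∀ a, a ∈ dom)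
    {R : Set (Fin n → A)} (hR : Invariant φ R) {C : Constraint n A} (hC : Invariant φ C.rel) {l : ℕ}
    {U : List (Fin n → A)} (hU : IsRep φ {t | t ∈ U} (R ∩ {t | 0 < l → t ∈ C.prefixSolutions l})) :
    IsRep φ {t | t ∈ (nextBeta φ dom U ((List.ofFn C.scope).take (l + 1))
        (prefixRel (l + 1) (C.tuples.map fun t => List.ofFn t)).val).val}
      (R ∩ {t | 0 < l + 1 → t ∈ C.prefixSolutions (l + 1)}) := by
  have hset : C.prefixSolutions (l + 1) = {t : Fin n → A | ((List.ofFn C.scope).take (l + 1)).map t ∈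
      (prefixRel (l + 1) (C.tuples.map fun t => List.ofFn t)).val} :=
    Set.ext fun t => C.mem_prefixSolutions
  convert isRep_nextBeta hφ hn hdom (hR.inter ?_) hU (hset ▸ C.invariant_prefixSolutions hC (l + 1))
    using 1
  · rw [← hset, Set.inter_assoc]
    congr 1
    ext t
    constructor
    · intro h
      obtain ⟨u, hu, h'⟩ := h (by omega)
      exact ⟨fun _ => ⟨u, hu, fun x hx => h' x (by omega)⟩, u, hu, h'⟩
    · exact fun h _ => h.2
  · exact fun ts h h0 => C.invariant_prefixSolutions hC l ts fun x => h x h0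

theorem isRep_next (hφ : IsGMM φ) (hn : 0 < n) {dom : List A} (hdom : ∀ a, a ∈ dom)
    {R : Set (Fin n → A)} (hR : Invariant φ R) {U : List (Fin n → A)}
    (hU : IsRep φ {t | t ∈ U} R) {C : Constraint n A} (hC : Invariant φ C.rel) :
    IsRep φ {t | t ∈ (next φ dom U (List.ofFn C.scope) (C.tuples.map fun t => List.ofFn t)).val}
      (R ∩ {t | (fun x => t (C.scope x)) ∈ C.rel}) := by
  have := forEach_invariant
    (body := fun U l => (prefixRel (l + 1) (C.tuples.map fun t => List.ofFn t)).bind fun S' =>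
        pay (l + 1) (nextBeta φ dom U ((List.ofFn C.scope).take (l + 1)) S'))
    (l := List.range (List.ofFn C.scope).length) (s := U)
    -- The guard 0 < l makes the invariant true before the first iteration: `C.prefixSolutions 0` is
    -- empty if the constraint relation is.
    (fun l V => IsRep φ {t | t ∈ V} (R ∩ {t | 0 < l → t ∈ C.prefixSolutions l})) ?_ ?_
  · have hset : R ∩ {t | (fun x => t (C.scope x)) ∈ C.rel} = R ∩ {t | 0 <
        (List.range (List.ofFn C.scope).length).length → t ∈ C.prefixSolutions
          (List.range (List.ofFn C.scope).length).length} := ?_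
    · rw [hset]
      exact this
    -- The arity is positive, so the guard disappears at the end, and the full prefix determines the
    -- tuple.
    refine congrArg (R ∩ ·) (Set.ext fun t => ?_)
    simp only [List.length_range, List.length_ofFn, C.arity_pos, forall_const,
      Constraint.prefixSolutions, Set.mem_ofPred_eq, Fin.is_lt]
    constructor
    · exact fun h => ⟨_, h, fun _ => rfl⟩
    · rintro ⟨u, hu, h⟩
      rwa [show (fun x => t (C.scope x)) = u from funext h]
  · intro l hl V hV
    simp only [List.getElem_range, val_bind, val_pay]
    exact isRep_next_step hφ hn hdom hR hC hV
  · simpa using hU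

/-! ### Correctness of `Solve` -/

omit [DecidableEq A] [Fintype A] in
theorem IsRep.nonempty_iff (hk : 3 ≤ k) (hn : 0 < n) {U R : Set (Fin n → A)} (hU : IsRep φ U R) :
    U.Nonempty ↔ R.Nonempty := by
  refine ⟨fun h => h.mono hU.subset, fun ⟨t, ht⟩ => ?_⟩
  obtain ⟨u, hu, -⟩ := hU.proj {⟨0, hn⟩} (by simp) (by simp; omega) t ht
  exact ⟨u, hu⟩

omit [DecidableEq A] [Fintype A] in
theorem point_ofFn (d : A) {r : ℕ} {ls : Fin r → Fin n} (hls : Function.Injective ls)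
    (ds : Fin r → A) (x : Fin r) : point d (List.ofFn ls) (List.ofFn ds) (ls x) = ds x := by
  have hzip : (List.ofFn ls).zip (List.ofFn ds) = List.ofFn fun x => (ls x, ds x) := by
    refine List.ext_getElem (by simp) fun j h1 h2 => by simp
  -- The starting tuple is general and untouched coordinates are tracked, because the entry written
  -- first has to survive the later updates; injectivity of `ls` ensures that it does.
  have key : ∀ (r : ℕ) (ls : Fin r → Fin n) (ds : Fin r → A) (t : Fin n → A),
      Function.Injective ls → (∀ x, (List.ofFn fun x => (ls x, ds x)).foldl
        (fun t p => Function.update t p.1 p.2) t (ls x) = ds x) ∧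
      ∀ l, (∀ x, ls x ≠ l) → (List.ofFn fun x => (ls x, ds x)).foldl
        (fun t p => Function.update t p.1 p.2) t l = t l := by
    intro r
    induction r with
    | zero => exact fun ls ds t _ => ⟨fun x => x.elim0, fun l _ => by simp⟩
    | succ r ih =>
      intro ls ds t hls
      have ih' := ih (fun x => ls x.succ) (fun x => ds x.succ) (Function.update t (ls 0) (ds 0))
        (fun x y h => Fin.succ_injective _ (hls h))
      simp only [List.ofFn_succ, List.foldl_cons]
      refine ⟨fun x => ?_, fun l hl => ?_⟩
      · refine Fin.cases ?_ (fun x => ih'.1 x) x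
        rw [ih'.2 (ls 0) fun x h => Fin.succ_ne_zero x (hls h)]
        simp
      · rw [ih'.2 l fun x => hl x.succ, Function.update_of_ne (hl 0).symm]
  rw [point, hzip]
  exact (key r ls ds _ hls).1 x

omit [Fintype A] in
-- In A^n any values may be combined, so tuples equal to `d` outside the prescribed coordinates
-- realise every triple and every small projection.
theorem isRep_initialRep {dom : List A} (hdom : ∀ a, a ∈ dom) (d : A) :
    IsRep φ {t | t ∈ (initialRep (n := n) φ dom d).val} Set.univ := by
  have hmem : ∀ t : Fin n → A, t ∈ (initialRep (n := n) φ dom d).val ↔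
      (∃ i a b, MinorityPair φ a b ∧ (t = point d [i] [a] ∨ t = point d [i] [b])) ∨
      ∃ r < k - 1, ∃ (ls : Fin (r + 1) → Fin n) (ds : Fin (r + 1) → A), StrictMono ls ∧
        t = point d (List.ofFn ls) (List.ofFn ds) := by
    intro t
    simp only [initialRep, val_bind]
    rw [mem_forSubtuples (F := fun ls ds t => t = point d ls ds) hdom,
      mem_forMinority (F := fun i a b t => t = point d [i] [a] ∨ t = point d [i] [b]) hdom]
    · simp
    · intro V i a b t _
      simp [mem_insertT, or_assoc]
    · intro V ls ds t
      simp [mem_insertT]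
  refine ⟨fun _ _ => trivial, ?_, ?_⟩
  · intro i a b hab _ _ _ _ _
    refine ⟨_, (hmem _).2 (Or.inl ⟨i, a, b, hab, Or.inl rfl⟩), _,
      (hmem _).2 (Or.inl ⟨i, a, b, hab, Or.inr rfl⟩), fun l hl => ?_, ?_, ?_⟩
    · simp [point, Function.update_of_ne hl.ne]
    · simp [point]
    · simp [point]
  · intro I hI hIk t _
    obtain ⟨r, hr, ls, hls, hI⟩ := exists_ofFn_of_finset (k := k) hI hIk
    refine ⟨_, (hmem _).2 (Or.inr ⟨r, hr, ls, fun x => t (ls x), hls, rfl⟩), fun l hl => ?_⟩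
    obtain ⟨x, rfl⟩ := (hI l).1 hl
    exact point_ofFn d hls.injective _ x

/-- The tuples that satisfy the constraints of a list. -/
def constraintSolutions (Cs : List (Constraint n A)) : Set (Fin n → A) :=
  {t | ∀ C ∈ Cs, (fun x => t (C.scope x)) ∈ C.rel}

omit [DecidableEq A] [Fintype A] in
theorem invariant_constraintSolutions {Cs : List (Constraint n A)}
    (hCs : ∀ C ∈ Cs, Invariant φ C.rel) : Invariant φ (constraintSolutions Cs) :=
  fun ts hts C hC => hCs C hC (fun x y => ts x (C.scope y)) fun x => hts x C hC

/-- The loop invariant of `Solve`. -/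
theorem isRep_solve_step (hφ : IsGMM φ) (hn : 0 < n) {dom : List A} (hdom : ∀ a, a ∈ dom)
    {Cs : List (Constraint n A)} (hCs : ∀ C ∈ Cs, Invariant φ C.rel) {j : ℕ} (hj : j < Cs.length)
    {U : List (Fin n → A)} (hU : IsRep φ {t | t ∈ U} (constraintSolutions (Cs.take j))) :
    IsRep φ {t | t ∈ (next φ dom U (List.ofFn Cs[j].scope)
      (Cs[j].tuples.map fun t => List.ofFn t)).val} (constraintSolutions (Cs.take (j + 1))) := by
  convert isRep_next hφ hn hdom
    (invariant_constraintSolutions fun C hC => hCs C (List.mem_of_mem_take hC)) hU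
    (hCs Cs[j] (List.getElem_mem hj)) using 1
  ext t
  simp only [constraintSolutions, Set.mem_inter_iff, Set.mem_ofPred_eq,
    List.take_succ_eq_append_getElem hj, List.mem_append, List.mem_singleton, or_imp, forall_and,
    forall_eq]

/-- After j constraints the list represents their common solutions, starting from A^n for j = 0; the
final list is nonempty exactly when solutions of all constraints exist. -/
theorem solve_iff_satisfiable (hφ : IsGMM φ) (hn : 0 < n) {dom : List A} (hdom : ∀ a, a ∈ dom)
    (d : A) {P : CSPInstance n A} (hP : P ∈ CSP (Inv φ) n) :
    (solve φ dom d P).val = true ↔ P.Satisfiable := by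
  have h := forEach_invariant
    (body := fun U (C : Constraint n A) =>
      pay (C.arity * (C.tuples.length + 1))
        (next φ dom U (List.ofFn C.scope) (C.tuples.map fun t => List.ofFn t)))
    (l := P.constraints) (s := (initialRep φ dom d).val)
    (fun j V => IsRep φ {t | t ∈ V} (constraintSolutions (P.constraints.take j)))
    (fun j hj V hV => isRep_solve_step hφ hn hdom hP hj hV) (by
      convert isRep_initialRep (n := n) hdom d
      simp [constraintSolutions])
  have h' := h.nonempty_iff hφ.1 hn
  rw [List.take_length] at h'
  refine Iff.trans ?_ h'
  simp only [solve, val_bind, val_pay, val_ret, Bool.not_eq_true', List.isEmpty_eq_false_iff]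
  exact ⟨List.exists_mem_of_ne_nil _, fun ⟨t, ht⟩ => List.ne_nil_of_mem ht⟩

end Correctness

/-! ## Running time -/

section Time

variable {k n N s : ℕ} {A : Type u} [DecidableEq A] {φ : (Fin k → A) → A}

/-- The bound `(k + 1) N ^ (k - 1)` for the size of the computed representations. -/
def repSize (k N : ℕ) : ℕ := (k + 1) * N ^ (k - 1)

theorem repSize_mul (hk : 3 ≤ k) (N : ℕ) : repSize k N * N = (k + 1) * N ^ k := by
  rw [repSize, mul_assoc, ← pow_succ, Nat.sub_add_cancel (by omega)]

theorem monomial_le (hN : 1 ≤ N) (hs : 1 ≤ s) {a b p q : ℕ} (hp : a ≤ p) (hq : b ≤ q) :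
    N ^ a * s ^ b ≤ N ^ p * s ^ q :=
  Nat.mul_le_mul (Nat.pow_le_pow_right hN hp) (Nat.pow_le_pow_right hs hq)

/-- There are at most B^k argument sequences, and each result is compared with at most B tuples on
at most (k + 1) N coordinates. -/
theorem newTuple_time {B : ℕ} (hB : 1 ≤ B) (hN : 1 ≤ N) (hn : n ≤ N) {is : List (Fin n)}
    (his : is.length ≤ (k + 1) * N) {U : List (Fin n → A)} (hU : U.length ≤ B) :
    (newTuple φ is U).time ≤ (k + 7) ^ 2 * (B ^ (k + 1) * N) := by
  have h1 := time_words k hB hU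
  have h2 : (words k U).val.length ≤ B ^ k :=
    (length_words k U).trans (Nat.pow_le_pow_left hU k)
  have h3 := findFirst_time (l := (words k U).val) (f := fun ts =>
      (applyT φ ts).bind fun t =>
        (existsIn (fun u => test (2 * is.length + 1) (is.map t = is.map u)) U).bind fun old =>
          ret (if old then none else some t))
      (c := N * (k + 1) + 1 + (B * (2 * ((k + 1) * N) + 2) + 1)) (by
    intro ts _
    have h := existsIn_time (l := U) (c := 2 * is.length + 1)
      (p := fun u => test (2 * is.length + 1) (is.map (applyTuples φ ts) = is.map u)) (by simp)
    have h' : U.length * (2 * is.length + 1 + 1) ≤ B * (2 * ((k + 1) * N) + 2) :=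
      Nat.mul_le_mul hU (by omega)
    have h'' := Nat.mul_le_mul_right (k + 1) hn
    calc _ = n * (k + 1) + 1 + (existsIn (fun u => test (2 * is.length + 1)
          (is.map (applyTuples φ ts) = is.map u)) U).time := rfl
      _ ≤ _ := by omega)
  have e0 : 1 ≤ B ^ (k + 1) * N := Nat.mul_pos (Nat.one_le_pow _ _ hB) hN
  have e1 : B ^ k ≤ B ^ (k + 1) * N :=
    (Nat.pow_le_pow_right hB (by omega)).trans (Nat.le_mul_of_pos_right _ hN)
  have e2 : B ^ k * N ≤ B ^ (k + 1) * N := by gcongr; omega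
  have e3 : B ^ k * B ≤ B ^ (k + 1) * N := by
    rw [← pow_succ]; exact Nat.le_mul_of_pos_right _ hN
  calc (newTuple φ is U).time
      ≤ (k + 5) ^ 2 * B ^ k +
          (B ^ k * (N * (k + 1) + 1 + (B * (2 * ((k + 1) * N) + 2) + 1) + 1) + 1) := by
        refine Nat.add_le_add h1 (h3.trans ?_)
        gcongr
    _ = ((k + 5) ^ 2 + 3) * B ^ k + (k + 1) * (B ^ k * N) + 2 * (k + 1) * (B ^ (k + 1) * N) +
          2 * (B ^ k * B) + 1 := by ring
    _ ≤ ((k + 5) ^ 2 + 3) * (B ^ (k + 1) * N) + (k + 1) * (B ^ (k + 1) * N) +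
          2 * (k + 1) * (B ^ (k + 1) * N) + 2 * (B ^ (k + 1) * N) + B ^ (k + 1) * N := by gcongr
    _ = ((k + 5) ^ 2 + 3 * k + 9) * (B ^ (k + 1) * N) := by ring
    _ ≤ _ := by gcongr; nlinarith

variable [Fintype A]

/-- The number of iterations of `grow` is bounded by the number of projections. -/
theorem grow_bounds {R : Set (Fin n → A)} (hR : Invariant φ R) {is : List (Fin n)}
    {Q : Finset (List A)} (hQ : ∀ t ∈ R, is.map t ∈ Q) {B c : ℕ}
    (hc : ∀ V : List (Fin n → A), V.length ≤ B → (newTuple φ is V).time ≤ c)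
    (U : List (Fin n → A)) (hU : ∀ t ∈ U, t ∈ R) (m : ℕ)
    (hm : (U.map fun t => is.map t).toFinset.card + m = Q.card) (hB : U.length + m ≤ B) :
    (grow φ is U).val.length ≤ U.length + m ∧ (grow φ is U).time ≤ (m + 1) * (c + 1) := by
  induction U using grow_induction (φ := φ) (is := is) generalizing m with
  | none U h =>
    rw [grow_of_none h]
    have := hc U (by omega)
    exact ⟨by simp, by nlinarith⟩
  | some U t h ih =>
    obtain ⟨⟨ts, hts, ht⟩, hnew⟩ := newTuple_eq_some h
    have hU' : ∀ u ∈ t :: U, u ∈ R := by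
      simpa using ⟨ht ▸ hR ts fun x => hU _ (hts x), hU⟩
    -- `m` counts the members of `Q` not yet realised as projections. Every added tuple realises a
    -- new one, so the loop adds at most `m` tuples; the failing last search accounts for the 1 in m
    -- + 1.
    have hcard : ((t :: U).map fun t => is.map t).toFinset.card =
        (U.map fun t => is.map t).toFinset.card + 1 := by
      rw [List.map_cons, List.toFinset_cons, Finset.card_insert_of_notMem]
      simpa [eq_comm] using hnew
    have hle : ((t :: U).map fun t => is.map t).toFinset.card ≤ Q.card := by
      refine Finset.card_le_card fun x hx => ?_
      obtain ⟨u, hu, rfl⟩ := List.mem_map.1 (List.mem_toFinset.1 hx)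
      exact hQ u (hU' u hu)
    obtain ⟨m, rfl⟩ : ∃ m', m = m' + 1 := ⟨m - 1, by omega⟩
    obtain ⟨h1, h2⟩ := ih hU' m (by omega) (by simp only [List.length_cons]; omega)
    have := hc U (by omega)
    rw [grow_of_some h]
    refine ⟨by simpa [add_assoc, add_comm 1] using h1, ?_⟩
    calc _ ≤ c + 1 + (m + 1) * (c + 1) := by simp only; omega
      _ = _ := by ring

omit [DecidableEq A] in
/-- A relation whose projection to `is₀` is contained in `S₀` has few projections to the extensions
of `is₀`. -/
theorem exists_finset_projections {R : Set (Fin n → A)} {is₀ : List (Fin n)} {S₀ : List (List A)}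
    (hS₀ : ∀ t ∈ R, is₀.map t ∈ S₀) (ex : List (Fin n)) :
    ∃ Q : Finset (List A), (∀ t ∈ R, (is₀ ++ ex).map t ∈ Q) ∧
      Q.card ≤ S₀.length * Fintype.card A ^ ex.length := by
  classical
  refine ⟨(S₀.toFinset ×ˢ (Finset.univ : Finset (Fin ex.length → A))).image
    fun p => p.1 ++ List.ofFn p.2, fun t ht => ?_, ?_⟩
  · refine Finset.mem_image.2 ⟨(is₀.map t, fun x => t ex[x]), by simpa using hS₀ t ht, ?_⟩
    rw [List.map_append]
    congr 1
    exact List.ext_getElem (by simp) (by simp)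
  · refine Finset.card_image_le.trans ?_
    rw [Finset.card_product]
    refine Nat.mul_le_mul (List.toFinset_card_le _) ?_
    simp

/-- The constant in the time bound of `Nonempty`. -/
def nonemptyCost (k : ℕ) : ℕ :=
  2 * ((k + 7) ^ 2 + 1) * (k + 2) ^ (k + 1) + (3 * k + 10) * (k + 2)

/-- At most |S₀| |A|^k ≤ s N^k projections are possible, because only the at most k coordinates in
`ex` are free. With lists of length at most B = (k + 2) s N^k, each round takes time of order
B^(k+1) N; the exponents add up to k + k(k + 1) + 1 = (k + 1)^2 for N and k + 2 for s. -/
theorem nonemptyProc_time (hk : 3 ≤ k) (hn : 1 ≤ n) (hA : 1 ≤ Fintype.card A)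
    (hN : n * Fintype.card A = N) (hs : 1 ≤ s) {R : Set (Fin n → A)} (hR : Invariant φ R)
    {is₀ : List (Fin n)} {S₀ : List (List A)} (hS₀ : ∀ t ∈ R, is₀.map t ∈ S₀)
    (hs₀ : S₀.length ≤ s) (his₀ : is₀.length ≤ n) {ex : List (Fin n)} (hex : ex.length ≤ k)
    {U : List (Fin n → A)} (hU : ∀ t ∈ U, t ∈ R) (hUs : U.length ≤ repSize k N)
    {S : List (List A)} (hS : S.length ≤ s) :
    (nonemptyProc φ U (is₀ ++ ex) S).time ≤
      nonemptyCost k * (N ^ (k ^ 2 + 2 * k + 1) * s ^ (k + 2)) := by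
  have hN1 : 1 ≤ N := hN ▸ Nat.mul_pos hn hA
  have hnN : n ≤ N := hN ▸ Nat.le_mul_of_pos_right n hA
  have hAN : Fintype.card A ≤ N := hN ▸ Nat.le_mul_of_pos_left _ hn
  have hP : 1 ≤ s * N ^ k := Nat.mul_pos hs (Nat.one_le_pow _ _ hN1)
  obtain ⟨is, his⟩ : ∃ is, is = is₀ ++ ex := ⟨_, rfl⟩
  have hlen : is.length ≤ (k + 1) * N := by
    have : k ≤ k * N := Nat.le_mul_of_pos_right k hN1
    rw [his, List.length_append, Nat.add_mul]
    omega
  obtain ⟨Q, hQ, hQc⟩ := exists_finset_projections hS₀ ex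
  rw [← his] at hQ ⊢
  have hQs : Q.card ≤ s * N ^ k := hQc.trans <| Nat.mul_le_mul hs₀ <|
    (Nat.pow_le_pow_left hAN _).trans (Nat.pow_le_pow_right hN1 hex)
  -- The original representation contributes k + 1 to the factor, the added tuples contribute 1.
  set B := (k + 2) * (s * N ^ k) with hB
  have hB1 : 1 ≤ B := Nat.mul_pos (by omega) hP
  have hrep : repSize k N ≤ (k + 1) * (s * N ^ k) := by
    unfold repSize
    gcongr
    exact (Nat.pow_le_pow_right hN1 (Nat.sub_le k 1)).trans (Nat.le_mul_of_pos_left _ hs)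
  have hBsplit : B = (k + 1) * (s * N ^ k) + s * N ^ k := by rw [hB]; ring
  have hle : (U.map fun t => is.map t).toFinset.card ≤ Q.card := by
    refine Finset.card_le_card fun x hx => ?_
    obtain ⟨u, hu, rfl⟩ := List.mem_map.1 (List.mem_toFinset.1 hx)
    exact hQ u (hU u hu)
  obtain ⟨g1, g2⟩ := grow_bounds hR hQ (B := B)
    (fun V hV => newTuple_time (φ := φ) hB1 hN1 hnN hlen hV) U hU
    (Q.card - (U.map fun t => is.map t).toFinset.card) (by omega) (by omega)
  have g1' : (grow φ is U).val.length ≤ B := by omega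
  have g2' : (grow φ is U).time ≤
      2 * (s * N ^ k) * (((k + 7) ^ 2 + 1) * (B ^ (k + 1) * N)) := by
    refine g2.trans (Nat.mul_le_mul (by omega) ?_)
    have : 1 ≤ B ^ (k + 1) * N := Nat.mul_pos (Nat.one_le_pow _ _ hB1) hN1
    rw [Nat.add_mul]
    omega
  have f1 := findFirst_time (l := (grow φ is U).val) (f := fun t =>
      pay (is.length + 1)
        ((existsIn (fun x => test (is.length + 1) (is.map t = x)) S).bind fun b =>
          ret (if b then some t else none)))
      (c := is.length + 1 + (s * (is.length + 2) + 1)) (by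
    intro t _
    have h := existsIn_time (l := S) (c := is.length + 1)
      (p := fun x => test (is.length + 1) (is.map t = x)) (by simp)
    simp only [time_bind, time_ret, time_pay]
    have : S.length * (is.length + 1 + 1) ≤ s * (is.length + 2) := Nat.mul_le_mul_right _ hS
    omega)
  have hBsN : 1 ≤ B * s * N := Nat.mul_pos (Nat.mul_pos hB1 hs) hN1
  have b1 : B ≤ B * s * N :=
    (Nat.le_mul_of_pos_right B hs).trans (Nat.le_mul_of_pos_right _ hN1)
  have b2 : N ≤ B * s * N := Nat.le_mul_of_pos_left N (Nat.mul_pos hB1 hs)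
  have b3 : B * N ≤ B * s * N := Nat.mul_le_mul_right N (Nat.le_mul_of_pos_right B hs)
  have b4 : B * s ≤ B * s * N := Nat.le_mul_of_pos_right _ hN1
  have rest : is.length + 1 + ((grow φ is U).val.length *
      (is.length + 1 + (s * (is.length + 2) + 1) + 1) + 1) ≤ (3 * k + 10) * (B * s * N) := by
    calc _ ≤ (k + 1) * N + 1 + (B * ((k + 1) * N + 1 + (s * ((k + 1) * N + 2) + 1) + 1) + 1) := by
          gcongr
      _ = (k + 1) * N + (k + 1) * (B * N) + 3 * B + (k + 1) * (B * s * N) + 2 * (B * s) + 2 := by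
          ring
      _ ≤ (k + 1) * (B * s * N) + (k + 1) * (B * s * N) + 3 * (B * s * N) +
            (k + 1) * (B * s * N) + 2 * (B * s * N) + 2 * (B * s * N) := by
          gcongr
          omega
      _ = _ := by ring
  have total : (nonemptyProc φ U is S).time ≤ 2 * (s * N ^ k) *
      (((k + 7) ^ 2 + 1) * (B ^ (k + 1) * N)) + (3 * k + 10) * (B * s * N) := by
    simp only [nonemptyProc, time_pay, time_bind]
    omega
  have hBp : B ^ (k + 1) = (k + 2) ^ (k + 1) * (s ^ (k + 1) * N ^ (k * (k + 1))) := by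
    rw [hB, mul_pow, mul_pow, ← pow_mul]
  calc _ ≤ _ := total
    _ = 2 * ((k + 7) ^ 2 + 1) * (k + 2) ^ (k + 1) * (N ^ (k ^ 2 + 2 * k + 1) * s ^ (k + 2)) +
          (3 * k + 10) * (k + 2) * (N ^ (k + 1) * s ^ 2) := by rw [hBp, hB]; ring
    _ ≤ 2 * ((k + 7) ^ 2 + 1) * (k + 2) ^ (k + 1) * (N ^ (k ^ 2 + 2 * k + 1) * s ^ (k + 2)) +
          (3 * k + 10) * (k + 2) * (N ^ (k ^ 2 + 2 * k + 1) * s ^ (k + 2)) := by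
        have := monomial_le hN1 hs (a := k + 1) (b := 2) (p := k ^ 2 + 2 * k + 1) (q := k + 2)
          (by nlinarith) (by omega)
        gcongr
    _ = _ := by rw [nonemptyCost]; ring

omit [Fintype A] in
/-- The common shape of `Fix-values`, `Next-beta` and the computation of the initial
representation. -/
theorem collect_bounds (hk : 3 ≤ k) {dom : List A} (hN : n * dom.length = N) (hN1 : 1 ≤ N)
    {body₁ : List (Fin n → A) → Fin n → A → A → Timed (List (Fin n → A))}
    {body₂ : List (Fin n → A) → List (Fin n) → List A → Timed (List (Fin n → A))} {T₁ T₂ : ℕ}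
    (h₁ : ∀ V i a b, (body₁ V i a b).val.length ≤ V.length + 2)
    (h₂ : ∀ V ls ds, (body₂ V ls ds).val.length ≤ V.length + 1)
    (hT₁ : ∀ V i a b, V.length ≤ repSize k N → (body₁ V i a b).time ≤ T₁)
    (hT₂ : ∀ V (ls : List (Fin n)) (ds : List A), ls.length ≤ k - 1 → ds.length = ls.length →
      V.length ≤ repSize k N → (body₂ V ls ds).time ≤ T₂) :
    ((forMinority φ dom body₁ []).bind fun V =>
      forSubtuples (k - 1) dom body₂ V).val.length ≤ repSize k N ∧
    ((forMinority φ dom body₁ []).bind fun V => forSubtuples (k - 1) dom body₂ V).time ≤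
      (8 * k + 24 + T₁) * N ^ 2 + 4 * (k + 4) ^ 3 * N ^ (k - 1) * (T₂ + 1) := by
  have hd : 1 ≤ dom.length := Nat.pos_of_ne_zero (by intro h0; simp [h0] at hN; omega)
  have hn : 1 ≤ n := Nat.pos_of_ne_zero (by rintro rfl; simp at hN; omega)
  have hnN : n ≤ N := hN ▸ Nat.le_mul_of_pos_right n hd
  have hdN : dom.length ≤ N := hN ▸ Nat.le_mul_of_pos_left _ hn
  have hNN : N ≤ N ^ 2 := Nat.le_self_pow (by omega) N
  have hndd : n * (dom.length * dom.length) ≤ N ^ 2 := by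
    rw [← mul_assoc, hN, sq]; gcongr
  have hN2 : N ^ 2 ≤ N ^ (k - 1) := Nat.pow_le_pow_right hN1 (by omega)
  -- Two tuples per minority triple and one per small projection: 2 + (k - 1) is the factor k + 1 in
  -- `repSize`, and n|A|^2 ≤ N^2 ≤ N^(k-1) uses k ≥ 3.
  have hsz : n * (dom.length * (dom.length * 2)) + (k - 1) * (N ^ (k - 1) * 1) ≤ repSize k N := by
    calc _ = 2 * (n * (dom.length * dom.length)) + (k - 1) * N ^ (k - 1) := by ring
      _ ≤ 2 * N ^ (k - 1) + (k - 1) * N ^ (k - 1) := by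
          gcongr; exact hndd.trans hN2
      _ = (2 + (k - 1)) * N ^ (k - 1) := by ring
      _ = repSize k N := by rw [repSize]; congr 1; omega
  have l1 := length_forMinority (φ := φ) (dom := dom) h₁ []
  have l2 := length_forSubtuples (q := k - 1) hN hN1 h₂ (forMinority φ dom body₁ []).val
  have t1 := time_forMinority (φ := φ) (dom := dom) (M := repSize k N) h₁
    (fun V i a b hV => hT₁ V i a b (by omega)) (V := []) (by
      simp only [List.length_nil]; omega)
  have t2 := time_forSubtuples (q := k - 1) (M := repSize k N) hN hN1 h₂
    (fun V ls ds h1 h2 hV => hT₂ V ls ds h1 h2 (by omega))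
    (V := (forMinority φ dom body₁ []).val) (by simp only [List.length_nil] at l1; omega)
  rw [show k - 1 + 5 = k + 4 by omega] at t2
  simp only [List.length_nil] at l1
  refine ⟨by simp only [val_bind]; omega, ?_⟩
  simp only [time_bind]
  refine Nat.add_le_add (t1.trans ?_) t2
  have e1 : 1 ≤ N ^ 2 := Nat.one_le_pow _ _ hN1
  calc _ = (n * (dom.length * dom.length)) * (8 * (k + 2) + 2 + T₁) + 2 * (n * dom.length) +
        3 * n + 1 := by ring
    _ ≤ N ^ 2 * (8 * (k + 2) + 2 + T₁) + 2 * N ^ 2 + 3 * N ^ 2 + N ^ 2 := by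
        rw [hN]; gcongr; omega
    _ = _ := by ring

omit [Fintype A] in
/-- The time of an insertion into a representation. -/
theorem insertT_time_le (hk : 3 ≤ k) (hN1 : 1 ≤ N) (hn : n ≤ N) {V : List (Fin n → A)}
    (hV : V.length ≤ repSize k N + 1) (x : Fin n → A) :
    (insertT (n + 1) x V).time ≤ (3 * k + 8) * N ^ k := by
  have h := time_insertT (n + 1) x V
  have hL := repSize_mul hk N
  have e1 : N ≤ N ^ k := Nat.le_self_pow (by omega) N
  have e0 : repSize k N ≤ (k + 1) * N ^ k := hL ▸ Nat.le_mul_of_pos_right _ hN1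
  calc _ ≤ V.length * (n + 1 + 1) + 2 := h
    _ ≤ (repSize k N + 1) * (N + 1 + 1) + 2 := by gcongr
    _ = repSize k N * N + 2 * repSize k N + N + 4 * 1 := by ring
    _ ≤ (k + 1) * N ^ k + 2 * ((k + 1) * N ^ k) + N ^ k + 4 * N ^ k := by
        rw [hL]; gcongr; omega
    _ = _ := by ring

end Time

/-! ### Times of `Fix-values`, `Next-beta`, `Next` and `Solve` -/

section TotalTime

variable {k n N s : ℕ} {A : Type u} [DecidableEq A] {φ : (Fin k → A) → A}

theorem findWitness_time (U : List (Fin n → A)) (i : Fin n) (a b : A) :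
    (findWitness U i a b).time ≤ U.length * (U.length * (2 * n + 2) + 2) + 1 := by
  refine findFirst_time fun t _ => findFirst_time fun t' _ => ?_
  simp

theorem findWitness_time_le (hk : 3 ≤ k) (hN1 : 1 ≤ N) (hn : n ≤ N) {U : List (Fin n → A)}
    (hU : U.length ≤ repSize k N) (i : Fin n) (a b : A) :
    (findWitness U i a b).time ≤ 7 * (k + 1) ^ 2 * N ^ (2 * k) := by
  have hL := repSize_mul hk N
  have e0 : repSize k N ≤ (k + 1) * N ^ k := hL ▸ Nat.le_mul_of_pos_right _ hN1
  have e1 : 1 ≤ (k + 1) * N ^ k := Nat.mul_pos (by omega) (Nat.one_le_pow _ _ hN1)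
  calc _ ≤ U.length * (U.length * (2 * n + 2) + 2) + 1 := findWitness_time U i a b
    _ ≤ repSize k N * (repSize k N * (2 * N + 2) + 2) + 1 := by gcongr
    _ = repSize k N * (2 * (repSize k N * N) + 2 * repSize k N + 2) + 1 := by ring
    _ ≤ (k + 1) * N ^ k * (2 * ((k + 1) * N ^ k) + 2 * ((k + 1) * N ^ k) + 2 * ((k + 1) * N ^ k)) +
          (k + 1) * N ^ k * ((k + 1) * N ^ k) := by
        rw [hL]
        gcongr
        · omega
        · exact Nat.mul_pos e1 e1
    _ = _ := by ring

theorem insertT_insertT_time_le (hk : 3 ≤ k) (hN1 : 1 ≤ N) (hn : n ≤ N) {V : List (Fin n → A)}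
    (hV : V.length ≤ repSize k N) (x y : Fin n → A) :
    (insertT (n + 1) x V).time + (insertT (n + 1) y (insertT (n + 1) x V).val).time ≤
      2 * (3 * k + 8) * N ^ k := by
  have h1 := insertT_time_le hk hN1 hn (V := V) (by omega) x
  -- After the first insertion the list may be longer than `repSize k N` by one.
  have h2 := insertT_time_le hk hN1 hn (V := (insertT (n + 1) x V).val)
    ((length_insertT _ _ _).trans (by omega)) y
  calc _ ≤ (3 * k + 8) * N ^ k + (3 * k + 8) * N ^ k := Nat.add_le_add h1 h2
    _ = _ := by ring

theorem length_insertT_insertT (c : ℕ) (x y : Fin n → A) (V : List (Fin n → A)) :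
    (insertT c y (insertT c x V).val).val.length ≤ V.length + 2 :=
  (length_insertT _ _ _).trans (Nat.succ_le_succ (length_insertT _ _ _))

variable [Fintype A]

theorem length_eq_card {dom : List A} (hnd : dom.Nodup) (hdom : ∀ a, a ∈ dom) :
    dom.length = Fintype.card A := by
  rw [← List.toFinset_card_of_nodup hnd, ← Finset.card_univ]
  congr 1
  ext a
  simp [hdom]

/-- The constant in the time bound of an iteration of `Fix-values`. -/
def fixStepCost (k : ℕ) : ℕ :=
  (8 * k + 24 + (nonemptyCost k + 7 * (k + 1) ^ 2 + 8 * k + 21)) +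
    4 * (k + 4) ^ 3 * (nonemptyCost k + 3 * k + 9)

/-- The searches are for single tuples on at most k coordinates, so constraint relations do not
enter. The main term comes from N^(k-1) searches of order N^(k^2+2k+1) each; the minority triples
contribute at most N^2 ≤ N^(k-1) more. -/
theorem fixStep_bounds (hk : 3 ≤ k) (hn : 1 ≤ n) (hA : 1 ≤ Fintype.card A)
    (hN : n * Fintype.card A = N) {dom : List A} (hdl : dom.length = Fintype.card A)
    {R : Set (Fin n → A)} (hR : Invariant φ R)
    {U : List (Fin n → A)} (hU : ∀ t ∈ U, t ∈ R) (hUs : U.length ≤ repSize k N)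
    (c : Fin n) (e : A) :
    (fixStep φ dom U c e).val.length ≤ repSize k N ∧
    (fixStep φ dom U c e).time ≤ fixStepCost k * N ^ (k ^ 2 + 3 * k) := by
  have hN1 : 1 ≤ N := hN ▸ Nat.mul_pos hn hA
  have hnN : n ≤ N := hN ▸ Nat.le_mul_of_pos_right n hA
  have hne : ∀ (is : List (Fin n)) (S : List (List A)), is.length ≤ k → S.length ≤ 1 →
      (nonemptyProc φ U is S).time ≤ nonemptyCost k * N ^ (k ^ 2 + 2 * k + 1) := by
    intro is S his hS
    -- With no coordinates in `is₀`, the only projection is the empty tuple, which allows s = 1.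
    simpa using nonemptyProc_time hk hn hA hN le_rfl hR (is₀ := []) (S₀ := [[]]) (by simp)
      (by simp) (by simp) his hU hUs hS
  have e1 : N ≤ N ^ (k ^ 2 + 2 * k + 1) := Nat.le_self_pow (by omega) N
  have e2 : N ^ k ≤ N ^ (k ^ 2 + 2 * k + 1) := Nat.pow_le_pow_right hN1 (by nlinarith)
  have e3 : N ^ (2 * k) ≤ N ^ (k ^ 2 + 2 * k + 1) := Nat.pow_le_pow_right hN1 (by nlinarith)
  have e4 : 1 ≤ N ^ (k ^ 2 + 2 * k + 1) := Nat.one_le_pow _ _ hN1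
  have hb := collect_bounds (n := n) (φ := φ) hk (hdl ▸ hN) hN1
    (body₁ := fun V i a b =>
      (nonemptyProc φ U [c, i] [[e, a]]).bind fun r =>
        match r with
        | none => ret V
        | some t₁ => (findWitness U i a b).bind fun r' =>
            match r' with
            | none => ret V
            | some (t₂, t₃) => (test 1 (c < i)).bind fun later =>
                if later then
                  (applyT φ (firstMidLast t₁ t₂ t₃)).bind fun t₄ =>
                  (applyT φ (restLast t₁ t₄)).bind fun t₅ =>
                  (insertT (n + 1) t₁ V).bind fun V' => insertT (n + 1) t₅ V'
                else ret V)
    (body₂ := fun V ls ds =>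
      (nonemptyProc φ U (ls ++ [c]) [ds ++ [e]]).bind fun r =>
        match r with
        | none => ret V
        | some t₆ => insertT (n + 1) t₆ V)
    (T₁ := (nonemptyCost k + 7 * (k + 1) ^ 2 + 8 * k + 21) * N ^ (k ^ 2 + 2 * k + 1))
    (T₂ := (nonemptyCost k + 3 * k + 8) * N ^ (k ^ 2 + 2 * k + 1)) ?_ ?_ ?_ ?_
  · refine ⟨hb.1, hb.2.trans ?_⟩
    have e5 : N ^ (k ^ 2 + 2 * k + 1) * N ^ (k - 1) = N ^ (k ^ 2 + 3 * k) := by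
      rw [← pow_add]; congr 1; omega
    have e6 : N ^ 2 ≤ N ^ (k - 1) := Nat.pow_le_pow_right hN1 (by omega)
    generalize hX : N ^ (k ^ 2 + 2 * k + 1) = X at *
    calc _ ≤ ((8 * k + 24) * X + (nonemptyCost k + 7 * (k + 1) ^ 2 + 8 * k + 21) * X) *
            N ^ (k - 1) + 4 * (k + 4) ^ 3 * N ^ (k - 1) *
            ((nonemptyCost k + 3 * k + 8) * X + X) := by
          gcongr
          exact Nat.le_mul_of_pos_right _ e4
      _ = fixStepCost k * (X * N ^ (k - 1)) := by rw [fixStepCost]; ring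
      _ = _ := by rw [e5]
  · intro V i a b
    cases h₁ : (nonemptyProc φ U [c, i] [[e, a]]).val with
    | none => simp [h₁]
    | some t₁ =>
      cases h₂ : (findWitness U i a b).val with
      | none => simp [h₁, h₂]
      | some p =>
        obtain ⟨t₂, t₃⟩ := p
        by_cases hci : c < i
        · simpa [h₁, h₂, hci] using length_insertT_insertT _ _ _ _
        · simp [h₁, h₂, hci]
  · intro V ls ds
    cases h : (nonemptyProc φ U (ls ++ [c]) [ds ++ [e]]).val with
    | none => simp [h]
    | some t₆ => simpa [h] using length_insertT _ _ _
  · intro V i a b hV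
    have t1 := hne [c, i] [[e, a]] (by simp; omega) (by simp)
    have t2 := findWitness_time_le hk hN1 hnN hUs i a b
    have t3 : n * (k + 1) ≤ N * (k + 1) := Nat.mul_le_mul_right _ hnN
    have e1' : N * (k + 1) ≤ (k + 1) * N ^ (k ^ 2 + 2 * k + 1) := by
      rw [mul_comm]; gcongr
    have t2' : (findWitness U i a b).time ≤ 7 * (k + 1) ^ 2 * N ^ (k ^ 2 + 2 * k + 1) :=
      t2.trans (by gcongr)
    have e2' := Nat.mul_le_mul_left (2 * (3 * k + 8)) e2
    have e4' : 0 ≤ k * N ^ (k ^ 2 + 2 * k + 1) := Nat.zero_le _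
    have e5' : 0 ≤ (k + 1) ^ 2 * N ^ (k ^ 2 + 2 * k + 1) := Nat.zero_le _
    simp only [time_bind]
    cases h₁ : (nonemptyProc φ U [c, i] [[e, a]]).val with
    | none => simp only [time_ret]; linarith
    | some t₁ =>
      simp only [time_bind]
      cases h₂ : (findWitness U i a b).val with
      | none => simp only [time_ret]; linarith
      | some p =>
        obtain ⟨t₂, t₃⟩ := p
        by_cases hci : c < i
        · have t5 := insertT_insertT_time_le hk hN1 hnN hV t₁ (switch φ t₁ t₂ t₃)
          simp only [time_bind, time_test, val_test, decide_eq_true hci, if_true, applyT, time_pay,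
            time_ret, val_pay, val_ret]
          simp only [switch] at t5
          linarith
        · simp only [time_bind, time_test, val_test, decide_eq_false hci, Bool.false_eq_true,
            if_false, time_ret]
          linarith
  · intro V ls ds hls hds hV
    have t1 := hne (ls ++ [c]) [ds ++ [e]] (by simp; omega) (by simp)
    have e2' := Nat.mul_le_mul_left (3 * k + 8) e2
    simp only [time_bind]
    cases h : (nonemptyProc φ U (ls ++ [c]) [ds ++ [e]]).val with
    | none => simp only [time_ret]; linarith [Nat.zero_le ((3 * k + 8) * N ^ k)]
    | some t₆ =>
      have t2 := insertT_time_le hk hN1 hnN (V := V) (by omega) t₆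
      simp only
      linarith

/-- Each iteration builds its list from the empty one, so sizes do not accumulate over the at most n
iterations. The invariant `IsRep` is carried along because the time of an iteration is bounded only
for parts of `R`. -/
theorem fixValues_bounds (hφ : IsGMM φ) (hn : 1 ≤ n) (hA : 1 ≤ Fintype.card A)
    (hN : n * Fintype.card A = N) {dom : List A} (hdom : ∀ a, a ∈ dom)
    (hdl : dom.length = Fintype.card A) {R : Set (Fin n → A)} (hR : Invariant φ R)
    {U : List (Fin n → A)} (hU : IsRep φ {t | t ∈ U} R) (hUs : U.length ≤ repSize k N)
    (t : Fin n → A) (i : Fin n) :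
    (fixValues φ dom U (((List.finRange n).take i.val).map t)).val.length ≤ repSize k N ∧
    (fixValues φ dom U (((List.finRange n).take i.val).map t)).time ≤
      (fixStepCost k + 4) * N ^ (k ^ 2 + 3 * k + 1) := by
  have hN1 : 1 ≤ N := hN ▸ Nat.mul_pos hn hA
  have hnN : n ≤ N := hN ▸ Nat.le_mul_of_pos_right n hA
  have hstep : ∀ j (hj : j < ((List.finRange n).zip (((List.finRange n).take i.val).map t)).length)
      (V : List (Fin n → A)),
      (IsRep φ {t | t ∈ V} (R ∩ {u | ∀ l : Fin n, l.val < j → u l = t l}) ∧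
        V.length ≤ repSize k N) →
      (IsRep φ {u | u ∈ (fixStep φ dom V
          ((List.finRange n).zip (((List.finRange n).take i.val).map t))[j].1
          ((List.finRange n).zip (((List.finRange n).take i.val).map t))[j].2).val}
          (R ∩ {u | ∀ l : Fin n, l.val < j + 1 → u l = t l}) ∧
        (fixStep φ dom V ((List.finRange n).zip (((List.finRange n).take i.val).map t))[j].1
          ((List.finRange n).zip (((List.finRange n).take i.val).map t))[j].2).val.length ≤
          repSize k N) ∧
        (fixStep φ dom V ((List.finRange n).zip (((List.finRange n).take i.val).map t))[j].1
          ((List.finRange n).zip (((List.finRange n).take i.val).map t))[j].2).time ≤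
          fixStepCost k * N ^ (k ^ 2 + 3 * k) := by
    intro j hj V hV
    obtain ⟨hj', he⟩ := zip_take_getElem t i hj
    rw [he]
    have hb := fixStep_bounds (φ := φ) hφ.1 hn hA hN hdl hR (fun u hu => (hV.1.subset hu).1) hV.2
      ⟨j, hj'⟩ (t ⟨j, hj'⟩)
    exact ⟨⟨isRep_fixValues_step hφ hn hdom hR hj' hV.1, hb.1⟩, hb.2⟩
  have h0 : IsRep φ {t | t ∈ U} (R ∩ {u | ∀ l : Fin n, l.val < 0 → u l = t l}) ∧
      U.length ≤ repSize k N := by simpa using ⟨hU, hUs⟩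
  have hv := forEach_invariant (body := fun U (ce : Fin n × A) => fixStep φ dom U ce.1 ce.2)
    _ (fun j hj V hV => (hstep j hj V hV).1) h0
  have ht := forEach_time (body := fun U (ce : Fin n × A) => fixStep φ dom U ce.1 ce.2)
    _ hstep h0
  refine ⟨hv.2, ?_⟩
  rw [length_zip_take] at ht
  have hi : i.val ≤ N := by omega
  have e1 : 1 ≤ N ^ (k ^ 2 + 3 * k + 1) := Nat.one_le_pow _ _ hN1
  have e2 : N ≤ N ^ (k ^ 2 + 3 * k + 1) := Nat.le_self_pow (by omega) N
  simp only [fixValues, time_pay]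
  calc _ ≤ n + 1 + (N * (fixStepCost k * N ^ (k ^ 2 + 3 * k) + 1) + 1) :=
        Nat.add_le_add_left (ht.trans (by gcongr)) _
    _ = fixStepCost k * N ^ (k ^ 2 + 3 * k + 1) + N + n + 2 := by ring
    _ ≤ fixStepCost k * N ^ (k ^ 2 + 3 * k + 1) + N ^ (k ^ 2 + 3 * k + 1) +
          N ^ (k ^ 2 + 3 * k + 1) + 2 * N ^ (k ^ 2 + 3 * k + 1) := by gcongr <;> omega
    _ = _ := by ring

omit [DecidableEq A] [Fintype A] in
theorem length_extendRel (S : List (List A)) (ds : List A) :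
    (extendRel S ds).val.length ≤ S.length := by
  refine (forEach_measure List.length (g := 1) ?_ _).trans (by simp)
  simp

omit [DecidableEq A] [Fintype A] in
theorem time_extendRel {S : List (List A)} {l : ℕ} (hS : ∀ x ∈ S, x.length ≤ l) (ds : List A) :
    (extendRel S ds).time ≤ S.length * (l + ds.length + 1 + 1) + 1 := by
  refine forEach_time (fun _ _ => True) (fun j hj acc _ => ⟨trivial, ?_⟩) trivial
  have := hS _ (List.getElem_mem hj)
  simp only [time_pay, time_ret]
  omega

/-- The constant in the time bounds of the loop bodies of `Next-beta`. -/
def nextBetaBodyCost (k : ℕ) : ℕ :=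
  2 * (k + 4) + 2 * nonemptyCost k + 2 + (fixStepCost k + 4) + 2 * (3 * k + 8)

/-- The constant in the time bound of `Next-beta`. -/
def nextBetaCost (k : ℕ) : ℕ :=
  (8 * k + 24 + nextBetaBodyCost k) + 4 * (k + 4) ^ 3 * (nextBetaBodyCost k + 1)

/-- Since `R` already projects into `S₀` on `is₀`, only the at most one new coordinate in `ex` and k
- 1 further ones are free in a search; this is why `Next` works by prefixes. The exponent of N comes
from the at most N^2 calls of `Fix-values`, that of s from `Nonempty`. -/
theorem nextBeta_bounds (hφ : IsGMM φ) (hn : 1 ≤ n) (hA : 1 ≤ Fintype.card A)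
    (hN : n * Fintype.card A = N) (hs : 1 ≤ s) {dom : List A} (hdom : ∀ a, a ∈ dom)
    (hdl : dom.length = Fintype.card A) {R : Set (Fin n → A)} (hR : Invariant φ R)
    {U : List (Fin n → A)} (hU : IsRep φ {t | t ∈ U} R) (hUs : U.length ≤ repSize k N)
    {is₀ ex : List (Fin n)} {S₀ S : List (List A)} (hS₀ : ∀ t ∈ R, is₀.map t ∈ S₀)
    (hs₀ : S₀.length ≤ s) (his₀ : is₀.length ≤ n) (hex : ex.length ≤ 1) (hS : S.length ≤ s)
    (hSn : ∀ x ∈ S, x.length ≤ n) :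
    (nextBeta φ dom U (is₀ ++ ex) S).val.length ≤ repSize k N ∧
    (nextBeta φ dom U (is₀ ++ ex) S).time ≤
      nextBetaCost k * (N ^ (k ^ 2 + 3 * k + 3) * s ^ (k + 2)) := by
  have hk := hφ.1
  have hN1 : 1 ≤ N := hN ▸ Nat.mul_pos hn hA
  have hnN : n ≤ N := hN ▸ Nat.le_mul_of_pos_right n hA
  have hne : ∀ (V : List (Fin n → A)) (ls : List (Fin n)) (ds : List A), (∀ t ∈ V, t ∈ R) →
      V.length ≤ repSize k N → ls.length ≤ k - 1 →
      (nonemptyProc φ V (is₀ ++ ex ++ ls) (extendRel S ds).val).time ≤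
        nonemptyCost k * (N ^ (k ^ 2 + 2 * k + 1) * s ^ (k + 2)) := by
    intro V ls ds hV hVs hls
    rw [List.append_assoc]
    exact nonemptyProc_time hk hn hA hN hs hR hS₀ hs₀ his₀ (by simp; omega) hV hVs
      ((length_extendRel S ds).trans hS)
  have hexT : ∀ ds : List A, ds.length ≤ k - 1 → (extendRel S ds).time ≤ (k + 4) * (N ^ 1 * s ^ 1) := by
    intro ds hds
    have e1 : s ≤ N * s := Nat.le_mul_of_pos_left _ hN1
    have e2 : 1 ≤ N * s := Nat.mul_pos hN1 hs
    calc _ ≤ S.length * (n + ds.length + 1 + 1) + 1 := time_extendRel hSn ds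
      _ ≤ s * (N + (k + 1)) + 1 := by gcongr ?_ * ?_ + 1; omega
      _ = N * s + (k + 1) * s + 1 := by ring
      _ ≤ N * s + (k + 1) * (N * s) + N * s := by gcongr
      _ ≤ _ := by rw [pow_one, pow_one]; linarith [Nat.zero_le (k * (N * s))]
  have e0 : 1 ≤ N ^ (k ^ 2 + 2 * k + 1) * s ^ (k + 2) :=
    Nat.mul_pos (Nat.one_le_pow _ _ hN1) (Nat.one_le_pow _ _ hs)
  have e1 : N ^ 1 * s ^ 1 ≤ N ^ (k ^ 2 + 2 * k + 1) * s ^ (k + 2) :=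
    monomial_le hN1 hs (by omega) (by omega)
  have e2 : N ^ k * s ^ 0 ≤ N ^ (k ^ 2 + 2 * k + 1) * s ^ (k + 2) :=
    monomial_le hN1 hs (by nlinarith) (by omega)
  have e3 : N ^ (k ^ 2 + 2 * k + 1) * s ^ (k + 2) ≤ N ^ (k ^ 2 + 3 * k + 1) * s ^ (k + 2) :=
    monomial_le hN1 hs (by omega) le_rfl
  have e4 : N ^ (k ^ 2 + 3 * k + 1) * s ^ 0 ≤ N ^ (k ^ 2 + 3 * k + 1) * s ^ (k + 2) :=
    monomial_le hN1 hs le_rfl (by omega)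
  have e5 : N ^ 1 * s ^ 0 ≤ N ^ (k ^ 2 + 3 * k + 1) * s ^ (k + 2) :=
    monomial_le hN1 hs (by omega) (by omega)
  rw [pow_zero, mul_one] at e2 e4 e5
  rw [pow_one] at e5
  -- X is the order of a call of `Nonempty`, and Y that of a call of `Fix-values` enlarged by the
  -- same power of s so that X ≤ Y. Hiding the powers makes the estimates linear.
  obtain ⟨X, hX⟩ : ∃ X, X = N ^ (k ^ 2 + 2 * k + 1) * s ^ (k + 2) := ⟨_, rfl⟩
  obtain ⟨Y, hY⟩ : ∃ Y, Y = N ^ (k ^ 2 + 3 * k + 1) * s ^ (k + 2) := ⟨_, rfl⟩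
  rw [← hX] at e0 e1 e2 e3
  rw [← hY] at e3 e4 e5
  rw [← hX] at hne
  have hb := collect_bounds (n := n) (φ := φ) hk (hdl ▸ hN) hN1
    (body₁ := fun V i a b =>
      (extendRel S [a]).bind fun Sa =>
      (nonemptyProc φ U (is₀ ++ ex ++ [i]) Sa).bind fun r =>
        match r with
        | none => ret V
        | some t₁ =>
            (pay (n + 1) (fixValues φ dom U (((List.finRange n).take i.val).map t₁))).bind fun F =>
            (extendRel S [b]).bind fun Sb =>
            (nonemptyProc φ F (is₀ ++ ex ++ [i]) Sb).bind fun r' =>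
              match r' with
              | none => ret V
              | some t₂ => (insertT (n + 1) t₁ V).bind fun V' => insertT (n + 1) t₂ V')
    (body₂ := fun V ls ds =>
      (extendRel S ds).bind fun Sd =>
      (nonemptyProc φ U (is₀ ++ ex ++ ls) Sd).bind fun r =>
        match r with
        | none => ret V
        | some t₃ => insertT (n + 1) t₃ V)
    (T₁ := nextBetaBodyCost k * Y) (T₂ := nextBetaBodyCost k * X) ?_ ?_ ?_ ?_
  · refine ⟨hb.1, hb.2.trans ?_⟩
    have e6 : X * N ^ (k - 1) ≤ N ^ (k ^ 2 + 3 * k + 3) * s ^ (k + 2) := by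
      rw [hX, mul_right_comm, ← pow_add]
      exact monomial_le hN1 hs (by omega) le_rfl
    have e7 : Y * N ^ 2 = N ^ (k ^ 2 + 3 * k + 3) * s ^ (k + 2) := by
      rw [hY, mul_right_comm, ← pow_add]
    calc _ ≤ ((8 * k + 24) * Y + nextBetaBodyCost k * Y) * N ^ 2 +
            4 * (k + 4) ^ 3 * N ^ (k - 1) * (nextBetaBodyCost k * X + X) := by
          gcongr
          exact Nat.le_mul_of_pos_right _ (e0.trans e3)
      _ = (8 * k + 24 + nextBetaBodyCost k) * (Y * N ^ 2) +
            4 * (k + 4) ^ 3 * (nextBetaBodyCost k + 1) * (X * N ^ (k - 1)) := by ring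
      _ ≤ (8 * k + 24 + nextBetaBodyCost k) * (N ^ (k ^ 2 + 3 * k + 3) * s ^ (k + 2)) +
            4 * (k + 4) ^ 3 * (nextBetaBodyCost k + 1) *
              (N ^ (k ^ 2 + 3 * k + 3) * s ^ (k + 2)) := by
          rw [e7]; gcongr
      _ = _ := by rw [nextBetaCost]; ring
  · intro V i a b
    simp only [val_bind]
    cases h₁ : (nonemptyProc φ U (is₀ ++ ex ++ [i]) (extendRel S [a]).val).val with
    | none => simp
    | some t₁ =>
      simp only [val_bind, val_pay]
      cases h₂ : (nonemptyProc φ (fixValues φ dom U (((List.finRange n).take i.val).map t₁)).val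
          (is₀ ++ ex ++ [i]) (extendRel S [b]).val).val with
      | none => simp
      | some t₂ => exact length_insertT_insertT _ _ _ _
  · intro V ls ds
    simp only [val_bind]
    cases h : (nonemptyProc φ U (is₀ ++ ex ++ ls) (extendRel S ds).val).val with
    | none => simp
    | some t₃ => exact length_insertT _ _ _
  · intro V i a b hV
    have t1 := hne U [i] [a] hU.subset hUs (by simp; omega)
    have t2 := hexT [a] (by simp; omega)
    have t3 := hexT [b] (by simp; omega)
    have e1' := Nat.mul_le_mul_left (k + 4) (e1.trans e3)
    have e2' := Nat.mul_le_mul_left (2 * (3 * k + 8)) (e2.trans e3)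
    have e3' := Nat.mul_le_mul_left (nonemptyCost k) e3
    have e4' := Nat.mul_le_mul_left (fixStepCost k + 4) e4
    have e8 : nextBetaBodyCost k * Y = 2 * ((k + 4) * Y) + 2 * (nonemptyCost k * Y) + 2 * Y +
      (fixStepCost k + 4) * Y + 2 * (3 * k + 8) * Y := by rw [nextBetaBodyCost]; ring
    have e9 := e0.trans e3
    rw [e8]
    simp only [time_bind]
    cases h₁ : (nonemptyProc φ U (is₀ ++ ex ++ [i]) (extendRel S [a]).val).val with
    | none => simp only [time_ret]; omega
    | some t₁ =>
      have hF := isRep_fixValues hφ hn hdom hR hU t₁ i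
      have hFb := fixValues_bounds hφ hn hA hN hdom hdl hR hU hUs t₁ i
      -- Fixing values leaves a part of `R`, so the same bound on the number of projections serves.
      have t4 := hne (fixValues φ dom U (((List.finRange n).take i.val).map t₁)).val [i] [b]
        (fun t ht => (hF.subset ht).1) hFb.1 (by simp; omega)
      have t5 := hFb.2
      simp only [time_bind, time_pay, val_pay]
      cases h₂ : (nonemptyProc φ (fixValues φ dom U (((List.finRange n).take i.val).map t₁)).val
          (is₀ ++ ex ++ [i]) (extendRel S [b]).val).val with
      | none => simp only [time_ret]; omega
      | some t₂ =>
        have t6 := insertT_insertT_time_le hk hN1 hnN hV t₁ t₂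
        simp only [time_bind]
        omega
  · intro V ls ds hls hds hV
    have t1 := hne U ls ds hU.subset hUs hls
    have t2 := hexT ds (by omega)
    have e1' := Nat.mul_le_mul_left (k + 4) e1
    have e2' := Nat.mul_le_mul_left (3 * k + 8) e2
    have e8 : nextBetaBodyCost k * X = 2 * ((k + 4) * X) + 2 * (nonemptyCost k * X) + 2 * X +
      (fixStepCost k + 4) * X + 2 * ((3 * k + 8) * X) := by rw [nextBetaBodyCost]; ring
    rw [e8]
    simp only [time_bind]
    cases h : (nonemptyProc φ U (is₀ ++ ex ++ ls) (extendRel S ds).val).val with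
    | none => simp only [time_ret]; omega
    | some t₃ =>
      have t6 := insertT_time_le hk hN1 hnN (V := V) (by omega) t₃
      simp only
      omega

omit [Fintype A] in
theorem length_prefixRel (l : ℕ) (S : List (List A)) :
    (prefixRel l S).val.length ≤ S.length := by
  refine (forEach_measure List.length (g := 1) ?_ _).trans (by simp)
  intro acc x _
  exact length_insertT _ _ _

omit [Fintype A] in
theorem time_prefixRel (l : ℕ) (S : List (List A)) :
    (prefixRel l S).time ≤ S.length * (l + 1 + (S.length * (l + 2) + 2) + 1) + 1 := by
  refine forEach_time_measure List.length (g := 1) (M := S.length) ?_ ?_ (by simp)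
  · intro acc x _
    exact length_insertT _ _ _
  · intro acc x _ hacc
    have := time_insertT (l + 1) (x.take l) acc
    have h' : acc.length * (l + 1 + 1) ≤ S.length * (l + 2) := Nat.mul_le_mul_right _ (by omega)
    simp only [time_pay]
    omega

/-- There are at most n ≤ N rounds of `Next-beta`; computing a prefix relation takes time of order N
s^2 only. -/
theorem next_bounds (hφ : IsGMM φ) (hn : 1 ≤ n) (hA : 1 ≤ Fintype.card A)
    (hN : n * Fintype.card A = N) {dom : List A} (hdom : ∀ a, a ∈ dom)
    (hdl : dom.length = Fintype.card A) {R : Set (Fin n → A)} (hR : Invariant φ R)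
    {U : List (Fin n → A)} (hU : IsRep φ {t | t ∈ U} R) (hUs : U.length ≤ repSize k N)
    {C : Constraint n A} (hC : Invariant φ C.rel) (hCn : C.arity ≤ n) (hs : 1 ≤ s)
    (hCs : C.tuples.length ≤ s) :
    (next φ dom U (List.ofFn C.scope) (C.tuples.map fun t => List.ofFn t)).val.length ≤
      repSize k N ∧
    (next φ dom U (List.ofFn C.scope) (C.tuples.map fun t => List.ofFn t)).time ≤
      (nextBetaCost k + 13) * (N ^ (k ^ 2 + 3 * k + 4) * s ^ (k + 2)) := by
  have hk := hφ.1
  have hN1 : 1 ≤ N := hN ▸ Nat.mul_pos hn hA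
  have hnN : n ≤ N := hN ▸ Nat.le_mul_of_pos_right n hA
  set S := C.tuples.map fun t => List.ofFn t with hSdef
  have hSs : S.length ≤ s := by simpa [hSdef] using hCs
  set T := 10 * (N * s ^ 2) + nextBetaCost k * (N ^ (k ^ 2 + 3 * k + 3) * s ^ (k + 2)) with hT
  have e1 : s ≤ s ^ 2 := Nat.le_self_pow (by omega) s
  have e2 : s ^ 2 ≤ N * s ^ 2 := Nat.le_mul_of_pos_left _ hN1
  have e3 : N ≤ N * s ^ 2 := Nat.le_mul_of_pos_right _ (Nat.one_le_pow _ _ hs)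
  have e4 : N * s ≤ N * s ^ 2 := Nat.mul_le_mul_left N e1
  have hpt : ∀ l < n, (prefixRel (l + 1) S).time ≤ 9 * (N * s ^ 2) := by
    intro l hl
    calc _ ≤ S.length * (l + 1 + 1 + (S.length * (l + 1 + 2) + 2) + 1) + 1 :=
          time_prefixRel (l + 1) S
      _ ≤ s * (N + 1 + (s * (N + 2) + 2) + 1) + 1 := by gcongr <;> omega
      _ = N * s + 4 * s + N * s ^ 2 + 2 * s ^ 2 + 1 := by ring
      _ ≤ _ := by omega
  have hstep : ∀ l (hl : l < (List.range (List.ofFn C.scope).length).length)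
      (V : List (Fin n → A)),
      (IsRep φ {t | t ∈ V} (R ∩ {t | 0 < l → t ∈ C.prefixSolutions l}) ∧
        V.length ≤ repSize k N) →
      (IsRep φ {t | t ∈ (nextBeta φ dom V ((List.ofFn C.scope).take (l + 1))
          (prefixRel (l + 1) S).val).val}
          (R ∩ {t | 0 < l + 1 → t ∈ C.prefixSolutions (l + 1)}) ∧
        (nextBeta φ dom V ((List.ofFn C.scope).take (l + 1))
          (prefixRel (l + 1) S).val).val.length ≤ repSize k N) ∧
        (prefixRel (l + 1) S).time + (l + 1 + (nextBeta φ dom V ((List.ofFn C.scope).take (l + 1))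
          (prefixRel (l + 1) S).val).time) ≤ T := by
    intro l hl V hV
    have hlC : l < C.arity := by simpa using hl
    have hinv : Invariant φ (R ∩ {t | 0 < l → t ∈ C.prefixSolutions l}) :=
      hR.inter fun ts h h0 => C.invariant_prefixSolutions hC l ts fun x => h x h0
    have htake : (List.ofFn C.scope).take (l + 1) =
        (List.ofFn C.scope).take l ++ [C.scope ⟨l, hlC⟩] := by
      rw [List.take_succ_eq_append_getElem (by simpa using hlC)]
      simp
    -- At l = 0 nothing has been imposed, and `prefixRel 0 S` is empty if `S` is, so the relation
    -- consisting of the empty tuple takes its place.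
    have hb := nextBeta_bounds (S := (prefixRel (l + 1) S).val) (ex := [C.scope ⟨l, hlC⟩])
      (is₀ := (List.ofFn C.scope).take l) (S₀ := if l = 0 then [[]] else (prefixRel l S).val)
      hφ hn hA hN hs hdom hdl hinv hV.1 hV.2 ?_ ?_ (by simp; omega) (by simp)
      ((length_prefixRel _ _).trans hSs) ?_
    · rw [← htake] at hb
      refine ⟨⟨isRep_next_step hφ hn hdom hR hC hV.1, hb.1⟩, ?_⟩
      have := hpt l (by omega)
      have := hb.2
      omega
    · intro t ht
      rcases Nat.eq_zero_or_pos l with rfl | h0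
      · simp
      · rw [if_neg (by omega)]
        exact C.mem_prefixSolutions.1 (ht.2 h0)
    · split_ifs
      · exact hs
      · exact (length_prefixRel _ _).trans hSs
    · intro x hx
      obtain ⟨x', -, rfl⟩ := mem_prefixRel.1 hx
      exact (List.length_take_le _ _).trans (by omega)
  have h0 : IsRep φ {t | t ∈ U} (R ∩ {t | 0 < 0 → t ∈ C.prefixSolutions 0}) ∧
      U.length ≤ repSize k N := by simpa using ⟨hU, hUs⟩
  have hbody : ∀ l (hl : l < (List.range (List.ofFn C.scope).length).length),
      (List.range (List.ofFn C.scope).length)[l] = l := by simp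
  have hv := forEach_invariant (body := fun U l => (prefixRel (l + 1) S).bind fun S' =>
        pay (l + 1) (nextBeta φ dom U ((List.ofFn C.scope).take (l + 1)) S')) _
    (fun l hl V hV => by rw [hbody l hl]; exact (hstep l hl V hV).1) h0
  have ht := forEach_time (body := fun U l => (prefixRel (l + 1) S).bind fun S' =>
        pay (l + 1) (nextBeta φ dom U ((List.ofFn C.scope).take (l + 1)) S')) (T := T) _
    (fun l hl V hV => by rw [hbody l hl]; exact hstep l hl V hV) h0
  refine ⟨hv.2, ht.trans ?_⟩
  have hX := monomial_le hN1 hs (a := 2) (b := 2) (p := k ^ 2 + 3 * k + 4) (q := k + 2)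
    (by omega) (by omega)
  have hX1 := monomial_le hN1 hs (a := 1) (b := 0) (p := k ^ 2 + 3 * k + 4) (q := k + 2)
    (by omega) (by omega)
  simp only [List.length_range, List.length_ofFn]
  calc _ ≤ N * (T + 1) + 1 := by gcongr; omega
    _ = 10 * (N ^ 2 * s ^ 2) + nextBetaCost k * (N ^ (k ^ 2 + 3 * k + 4) * s ^ (k + 2)) + N + 1 := by
        rw [hT]; ring
    _ ≤ _ := by
        rw [pow_one, pow_zero, mul_one] at hX1
        linarith

omit [Fintype A] in
theorem initialRep_bounds (hk : 3 ≤ k) {dom : List A} (hN : n * dom.length = N) (hN1 : 1 ≤ N)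
    (hnN : n ≤ N) (d : A) :
    (initialRep (n := n) φ dom d).val.length ≤ repSize k N ∧
    (initialRep (n := n) φ dom d).time ≤
      (8 * k + 24 + (6 * k + 20) + 4 * (k + 4) ^ 3 * (5 * k + 11)) * N ^ (2 * k) := by
  have e1 : N ≤ N ^ k := Nat.le_self_pow (by omega) N
  have e2 : 1 ≤ N ^ k := Nat.one_le_pow _ _ hN1
  have hb := collect_bounds (n := n) (φ := φ) hk hN hN1
    (body₁ := fun V i a b =>
      pay (2 * (n + 1)) ((insertT (n + 1) (point d [i] [a]) V).bind fun V' =>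
        insertT (n + 1) (point d [i] [b]) V'))
    (body₂ := fun V ls ds => pay (n + 2 * ls.length + 1) (insertT (n + 1) (point d ls ds) V))
    (T₁ := (6 * k + 20) * N ^ k) (T₂ := (5 * k + 10) * N ^ k) ?_ ?_ ?_ ?_
  · refine ⟨hb.1, hb.2.trans ?_⟩
    have e3 : N ^ k * N ^ 2 ≤ N ^ (2 * k) := by
      rw [← pow_add]; exact Nat.pow_le_pow_right hN1 (by omega)
    have e4 : N ^ k * N ^ (k - 1) ≤ N ^ (2 * k) := by
      rw [← pow_add]; exact Nat.pow_le_pow_right hN1 (by omega)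
    calc _ ≤ ((8 * k + 24) * N ^ k + (6 * k + 20) * N ^ k) * N ^ 2 +
          4 * (k + 4) ^ 3 * N ^ (k - 1) * ((5 * k + 10) * N ^ k + N ^ k) := by
          gcongr
          exact Nat.le_mul_of_pos_right _ e2
      _ = (8 * k + 24 + (6 * k + 20)) * (N ^ k * N ^ 2) +
          4 * (k + 4) ^ 3 * (5 * k + 11) * (N ^ k * N ^ (k - 1)) := by ring
      _ ≤ (8 * k + 24 + (6 * k + 20)) * N ^ (2 * k) +
          4 * (k + 4) ^ 3 * (5 * k + 11) * N ^ (2 * k) := by gcongr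
      _ = _ := by ring
  · intro V i a b
    exact length_insertT_insertT _ _ _ _
  · intro V ls ds
    exact length_insertT _ _ _
  · intro V i a b hV
    have := insertT_insertT_time_le hk hN1 hnN hV (point d [i] [a]) (point d [i] [b])
    simp only [time_pay, time_bind]
    linarith
  · intro V ls ds hls _ hV
    have := insertT_time_le hk hN1 hnN (V := V) (by omega) (point d ls ds)
    have e3 := Nat.le_mul_of_pos_right (2 * k + 1) e2
    simp only [time_pay]
    have : ls.length ≤ k := by omega
    linarith

omit [DecidableEq A] [Fintype A] in
theorem tuples_length_le_largestRel {P : CSPInstance n A} {C : Constraint n A}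
    (hC : C ∈ P.constraints) : C.tuples.length ≤ P.largestRel := by
  unfold CSPInstance.largestRel
  generalize P.constraints = Cs at hC
  induction Cs with
  | nil => simp at hC
  | cons D Ds ih =>
    rcases List.mem_cons.1 hC with rfl | hC
    · exact le_max_left _ _
    · exact (ih hC).trans (le_max_right _ _)

/-- The constant in the time bound of `Solve`. -/
def solveCost (k : ℕ) : ℕ :=
  (8 * k + 24 + (6 * k + 20) + 4 * (k + 4) ^ 3 * (5 * k + 11)) + (nextBetaCost k + 18)

/-- The m calls of `Next` dominate, as the initial representation takes only N^(2k) up to a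
constant. The maxima with 1 cover the cost that remains without constraints or with empty relations.
-/
theorem solve_time (hφ : IsGMM φ) {dom : List A} (hnd : dom.Nodup) (hdom : ∀ a, a ∈ dom) (d : A)
    (hn : 1 ≤ n) {P : CSPInstance n A} (hP : P ∈ CSP (Inv φ) n)
    (hPn : ∀ C ∈ P.constraints, C.arity ≤ n) :
    (solve φ dom d P).time ≤ solveCost k * max 1 P.numConstraints *
      (n * Fintype.card A) ^ ((k + 1) * (k + 2) + 2) * max 1 P.largestRel ^ (k + 3) := by
  have hk := hφ.1
  have hA : 1 ≤ Fintype.card A := Fintype.card_pos_iff.2 ⟨d⟩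
  have hdl := length_eq_card hnd hdom
  obtain ⟨N, hN⟩ : ∃ N, n * Fintype.card A = N := ⟨_, rfl⟩
  obtain ⟨s, hs⟩ : ∃ s, max 1 P.largestRel = s := ⟨_, rfl⟩
  obtain ⟨m, hm⟩ : ∃ m, max 1 P.numConstraints = m := ⟨_, rfl⟩
  have hs1 : 1 ≤ s := hs ▸ le_max_left _ _
  have hm1 : 1 ≤ m := hm ▸ le_max_left _ _
  have hmP : P.constraints.length ≤ m := hm ▸ le_max_right 1 P.numConstraints
  have hN1 : 1 ≤ N := hN ▸ Nat.mul_pos hn hA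
  have hnN : n ≤ N := hN ▸ Nat.le_mul_of_pos_right n hA
  have hCs : ∀ C ∈ P.constraints, C.tuples.length ≤ s := fun C hC =>
    (tuples_length_le_largestRel hC).trans (hs ▸ le_max_right _ _)
  rw [hN, hs, hm, show (k + 1) * (k + 2) + 2 = k ^ 2 + 3 * k + 4 by ring]
  have hi := initialRep_bounds (φ := φ) (n := n) hk (hdl ▸ hN) hN1 hnN d
  have ht := forEach_time
    (body := fun U (C : Constraint n A) =>
      pay (C.arity * (C.tuples.length + 1))
        (next φ dom U (List.ofFn C.scope) (C.tuples.map fun t => List.ofFn t)))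
    (l := P.constraints) (s := (initialRep φ dom d).val)
    (T := (nextBetaCost k + 15) * (N ^ (k ^ 2 + 3 * k + 4) * s ^ (k + 2)))
    (fun j V => IsRep φ {t | t ∈ V} (constraintSolutions (P.constraints.take j)) ∧
      V.length ≤ repSize k N)
    (fun j hj V hV => by
      have hmem := List.getElem_mem hj
      have hb := next_bounds hφ hn hA hN hdom hdl
        (invariant_constraintSolutions fun C hC => hP C (List.mem_of_mem_take hC)) hV.1 hV.2
        (hP _ hmem) (hPn _ hmem) hs1 (hCs _ hmem)
      refine ⟨⟨isRep_solve_step hφ hn hdom hP hj hV.1, hb.1⟩, ?_⟩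
      have e1 : P.constraints[j].arity * (P.constraints[j].tuples.length + 1) ≤ N * (s + s) :=
        Nat.mul_le_mul ((hPn _ hmem).trans hnN) (Nat.add_le_add (hCs _ hmem) hs1)
      have e2 := monomial_le hN1 hs1 (a := 1) (b := 1) (p := k ^ 2 + 3 * k + 4) (q := k + 2)
        (by omega) (by omega)
      have e3 := hb.2
      rw [pow_one, pow_one] at e2
      simp only [time_pay]
      linarith)
    ⟨by
      convert isRep_initialRep (n := n) hdom d
      simp [constraintSolutions], hi.1⟩
  have e1 := monomial_le hN1 hs1 (a := 2 * k) (b := 0) (p := k ^ 2 + 3 * k + 4) (q := k + 3)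
    (by nlinarith) (by omega)
  -- One factor s is given away here.
  have e2 := monomial_le hN1 hs1 (a := k ^ 2 + 3 * k + 4) (b := k + 2) (p := k ^ 2 + 3 * k + 4)
    (q := k + 3) le_rfl (by omega)
  have e3 : 1 ≤ N ^ (k ^ 2 + 3 * k + 4) * s ^ (k + 3) :=
    Nat.mul_pos (Nat.one_le_pow _ _ hN1) (Nat.one_le_pow _ _ hs1)
  rw [pow_zero, mul_one] at e1
  rw [mul_assoc]
  generalize N ^ (k ^ 2 + 3 * k + 4) * s ^ (k + 3) = X at *
  have e4 : X ≤ m * X := Nat.le_mul_of_pos_left _ hm1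
  have total : (solve φ dom d P).time ≤
      (8 * k + 24 + (6 * k + 20) + 4 * (k + 4) ^ 3 * (5 * k + 11)) * N ^ (2 * k) +
      (P.constraints.length *
        ((nextBetaCost k + 15) * (N ^ (k ^ 2 + 3 * k + 4) * s ^ (k + 2)) + 1) + 1 + 1) :=
    Nat.add_le_add hi.2 (Nat.add_le_add_right ht 1)
  calc _ ≤ _ := total
    _ ≤ (8 * k + 24 + (6 * k + 20) + 4 * (k + 4) ^ 3 * (5 * k + 11)) * (m * X) +
      (m * ((nextBetaCost k + 15) * X + X) + m * X + m * X) := by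
        gcongr
        · exact e1.trans e4
        · exact e3.trans e4
        · exact e3.trans e4
    _ = _ := by rw [solveCost]; ring

end TotalTime

end GMM

/-- The constant is a polynomial expression in quantities such as (k + 2)^(k+1) and depends on k
alone. Quantifying over `dom` and `d` makes the order in which A is listed and the default value
arbitrary. -/
theorem mainTheorem4 (k : ℕ) :
    ∃ K : ℕ, ∀ (A : Type*) [Fintype A] [DecidableEq A] (φ : (Fin k → A) → A), GMM.IsGMM φ →
      ∀ (dom : List A), dom.Nodup → (∀ a : A, a ∈ dom) → ∀ (d : A)
        (n : ℕ), 1 ≤ n → ∀ P ∈ GMM.CSP (GMM.Inv φ) n,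
        ((GMM.solve φ dom d P).val = true ↔ P.Satisfiable) ∧
        ((∀ C ∈ P.constraints, C.arity ≤ n) →
          (GMM.solve φ dom d P).time ≤
            K * max 1 P.numConstraints * (n * Fintype.card A) ^ ((k + 1) * (k + 2) + 2) *
              max 1 P.largestRel ^ (k + 3)) :=
  ⟨GMM.solveCost k, fun _ _ _ _ hφ _ hnd hdom d _ hn _ hP =>
    ⟨GMM.solve_iff_satisfiable hφ hn hdom d hP,
      fun hPn => GMM.solve_time hφ hnd hdom d hn hP hPn⟩⟩
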